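/- **Conventions.** Fix $N\ge 1$, let $B_j\subset\mathbb R^N$ be the closed ball of radius $j$ centred at $0$, and let $V$ be $\mathbb R^N$ or $\mathbb R^{N\times N}$. Let $\mathfrak C(V)$ be the set of Borel functions $f:\mathbb R\times\mathbb R^N\to V$ that have on each compact $K\subset\mathbb R^N$ an *$m$-bound*, i.e. some $m\in L^1_{loc}(\mathbb R)$ such that for a.e. $t$, $|f(t,x)|\le m(t)$ for all $x\in K$. Such an $f$ belongs to $\mathfrak{LC}$ if for each compact $K$ there is $l\in L^1_{loc}(\mathbb R)$ such that for a.e. $t$, $|f(t,x)-f(t,y)|\le l(t)|x-y|$ for all $x,y\in K$; it belongs to $\mathfrak{SC}$ if $f(t,\cdot)$ is continuous for a.e. $t$. Write $f_t(s,x)=f(s+t,x)$. A set $S\subset L^1_{loc}(\mathbb R)$ of nonnegative functions is *$L^1_{loc}$-bounded* if $\sup_{m\in S}\int_{-r}^r m<\infty$ for every $r>0$, and *$L^1_{loc}$-equicontinuous* if for all $r,\varepsilon>0$ there is $\delta>0$ with $\sup_{m\in S}\int_s^t m<\varepsilon$ whenever $-r\le s\le t\le r$ and $t-s<\delta$. A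 function $f$ has $L^1_{loc}$-bounded (resp. $L^1_{loc}$-equicontinuous) $m$-bounds if for each $j\in\mathbb N$ one can choose $m$-bounds on $B_j$ of the functions $f_t$, $t\in\mathbb R$, that form an $L^1_{loc}$-bounded (resp. $L^1_{loc}$-equicontinuous) set. **Setting.** Let $f\in\mathfrak{LC}$, with values in $\mathbb R^N$, be continuously differentiable in $x$ for a.e. $t$ and have $L^1_{loc}$-equicontinuous $m$-bounds, and let $J_xf\in\mathfrak{SC}$, with values in $\mathbb R^{N\times N}$, be its Jacobian in $x$. Put $m^j(t)=\sup_{x\in B_j}|f(t,x)|$ and $\theta_j(s)=\sup_{t\in\mathbb R}\int_t^{t+s}m^j(u)\,du$. For $j\in\mathbb N$ and $I=[q_1,q_2]$ with rational $q_1<q_2$, let $\mathcal K_j^I$ be the set of continuous $x:I\to B_j$ with $|x(s)-x(t)|\le\theta_j(|s-t|)$ for $s,t\in I$. Let $\Theta\mathfrak C$ (resp. $\mathfrak{W}\Theta\mathfrak C$) be the set of $h\in\mathfrak C(V)$ such that for all such $I,j$ and all $x_n,x\in\mathcal K^I_j$ with $x_n\to x$ uniformly, $\int_I|h(t,x_n(t))-h(t,x(t))|\,dt\to0$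 (resp. $\int_I h(t,x_n(t))\,dt\to\int_I h(t,x(t))\,dt$). Let $\mathcal T_\Theta$ (resp. $\sigma_\Theta$) be the topology generated by the seminorms $\sup_{x\in\mathcal K_j^I}\int_I|h(t,x(t))|\,dt$ (resp. $\sup_{x\in\mathcal K_j^I}|\int_I h(t,x(t))\,dt|$). Let $\mathbb H$ be the closure of $\{(f_t,(J_xf)_t):t\in\mathbb R\}$ either in $(\mathfrak{LC},\mathcal T_\Theta)\times(\Theta\mathfrak C,\mathcal T_\Theta)$ or, provided that $J_xf$ has $L^1_{loc}$-equicontinuous $m$-bounds, in $(\mathfrak{LC},\sigma_\Theta)\times(\mathfrak W\Theta\mathfrak C,\sigma_\Theta)$. Put $\Omega=\mathbb H\times\mathbb R^N$. For $\omega=(g,G,x_0)\in\Omega$ let $x(\cdot,g,x_0)$ be the (Carathéodory) solution of $\dot x=g(t,x)$, $x(0)=x_0$, assumed to be defined on all of $\mathbb R$; let $\omega_t=(g_t,G_t,x(t,g,x_0))$, and let $A(\omega)=\lim_{h\to0}\frac1h\int_0^hG(s,x(s,g,x_0))\,ds$ if this limit exists and $A(\omega)=0$ otherwise (so that $A(\omega_t)=G(t,x(t,g,x_0))$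 for a.e. $t$). Let $\Phi(t,\omega)$ be the fundamental matrix solution of $\dot y=A(\omega_t)y$ with $\Phi(0,\omega)=I_N$. A linear system $\dot y=B(t)y$ with fundamental matrix solution $\Phi$, $\Phi(0)=I_N$, has *exponential dichotomy* if there are a projection $P$ of $\mathbb R^N$ and constants $K\ge1$, $\alpha>0$ with $\|\Phi(t)P\Phi^{-1}(s)\|\le Ke^{-\alpha(t-s)}$ for $t\ge s$ and $\|\Phi(t)(I_N-P)\Phi^{-1}(s)\|\le Ke^{\alpha(t-s)}$ for $t\le s$. The *dichotomy spectrum* $\Sigma(\omega)$ is the set of $\gamma\in\mathbb R$ such that $\dot y=(A(\omega_t)-\gamma I_N)y$ does not have exponential dichotomy. **Proposition.** Let $\omega=(g,G,x_0)\in\Omega$. Assume that $G$ has $L^1_{loc}$-bounded $m$-bounds and that $x(\cdot,g,x_0)$ is bounded. Then the system $\dot y=A(\omega_t)\,y$ has *bounded growth*, i.e. there are constants $K\ge1$ and $\alpha\ge0$ with $$\|\Phi(t,\omega)\Phi^{-1}(s,\omega)\|\le Ke^{\alpha|t-s|}\qquad\text{for all }t,s\in\mathbb R,$$ and there are $k$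 with $1\le k\le N$ and reals $a_1\le b_1<a_2\le b_2<\dots<a_k\le b_k$ with $$\Sigma(\omega)=[a_1,b_1]\cup\dots\cup[a_k,b_k].$$ -/

import Mathlib

open Set Filter Topology MeasureTheory

namespace Carath

noncomputable section

/-- The Euclidean space `ℝ^N`. -/
abbrev E (N : ℕ) : Type := EuclideanSpace ℝ (Fin N)

/-- Linear endomorphisms of `ℝ^N` (that is, `N × N` matrices) with the operator norm. -/
abbrev L (N : ℕ) : Type := E N →L[ℝ] E N

/-! ### Carathéodory functions -/

section Classes

variable {N : ℕ} {V : Type} [NormedAddCommGroup V] [NormedSpace ℝ V]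

/-- `m` is an `m`-bound of `f` on `K`. -/
def IsMBound (f : ℝ → E N → V) (K : Set (E N)) (m : ℝ → ℝ) : Prop :=
  LocallyIntegrable m ∧ ∀ᵐ t : ℝ, ∀ x ∈ K, ‖f t x‖ ≤ m t

/-- `f` is Borel measurable and has an `m`-bound on every compact set. -/
def IsC [MeasurableSpace V] (f : ℝ → E N → V) : Prop :=
  Measurable (Function.uncurry f) ∧ ∀ K : Set (E N), IsCompact K → ∃ m, IsMBound f K m

/-- Lipschitz Carathéodory functions. -/
def LC (N : ℕ) (V : Type) [NormedAddCommGroup V] [MeasurableSpace V] : Set (ℝ → E N → V) :=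
  {f | IsC f ∧ ∀ K : Set (E N), IsCompact K → ∃ l : ℝ → ℝ, LocallyIntegrable l ∧
    ∀ᵐ t : ℝ, ∀ x ∈ K, ∀ y ∈ K, ‖f t x - f t y‖ ≤ l t * ‖x - y‖}

/-- Strong Carathéodory functions. -/
def SC (N : ℕ) (V : Type) [NormedAddCommGroup V] [MeasurableSpace V] : Set (ℝ → E N → V) :=
  {f | IsC f ∧ ∀ᵐ t : ℝ, Continuous (f t)}

/-- The set `𝒦_j^I`, `I = [q₁, q₂]`: curves that are continuous on `I`, take values in the closed
ball of radius `j` there, and admit `θ j` as a modulus of continuity on `I`. -/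
def curves (N : ℕ) (θ : ℕ → ℝ → ℝ) (q₁ q₂ : ℚ) (j : ℕ) : Set (ℝ → E N) :=
  {x | ContinuousOn x (Icc (q₁ : ℝ) q₂) ∧ MapsTo x (Icc (q₁ : ℝ) q₂) (Metric.closedBall 0 (j : ℝ)) ∧
    ∀ s ∈ Icc (q₁ : ℝ) q₂, ∀ t ∈ Icc (q₁ : ℝ) q₂, ‖x s - x t‖ ≤ θ j |s - t|}

/-- `Θ`-Carathéodory functions. -/
def TC (N : ℕ) (V : Type) [NormedAddCommGroup V] [MeasurableSpace V] (θ : ℕ → ℝ → ℝ) :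
    Set (ℝ → E N → V) :=
  {f | IsC f ∧ ∀ (j : ℕ) (q₁ q₂ : ℚ), q₁ < q₂ →
    ∀ (u : ℕ → ℝ → E N) (x : ℝ → E N), (∀ n, u n ∈ curves N θ q₁ q₂ j) → x ∈ curves N θ q₁ q₂ j →
      TendstoUniformlyOn u x atTop (Icc (q₁ : ℝ) q₂) →
      Tendsto (fun n => ∫ t in (q₁ : ℝ)..q₂, ‖f t (u n t) - f t (x t)‖) atTop (𝓝 0)}

/-- Weak `Θ`-Carathéodory functions. -/
def WTC (N : ℕ) (V : Type) [NormedAddCommGroup V] [NormedSpace ℝ V] [MeasurableSpace V]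
    (θ : ℕ → ℝ → ℝ) : Set (ℝ → E N → V) :=
  {f | IsC f ∧ ∀ (j : ℕ) (q₁ q₂ : ℚ), q₁ < q₂ →
    ∀ (u : ℕ → ℝ → E N) (x : ℝ → E N), (∀ n, u n ∈ curves N θ q₁ q₂ j) → x ∈ curves N θ q₁ q₂ j →
      TendstoUniformlyOn u x atTop (Icc (q₁ : ℝ) q₂) →
      Tendsto (fun n => ∫ t in (q₁ : ℝ)..q₂, f t (u n t)) atTop
        (𝓝 (∫ t in (q₁ : ℝ)..q₂, f t (x t)))}

/-- The seminorms generating the weak topology `σ_Θ`. -/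
def pSigma (θ : ℕ → ℝ → ℝ) (q₁ q₂ : ℚ) (j : ℕ) (f : ℝ → E N → V) : ℝ :=
  ⨆ x : curves N θ q₁ q₂ j, ‖∫ t in (q₁ : ℝ)..q₂, f t (x.1 t)‖

/-- The seminorms generating the strong topology `𝒯_Θ`. -/
def pStrong (θ : ℕ → ℝ → ℝ) (q₁ q₂ : ℚ) (j : ℕ) (f : ℝ → E N → V) : ℝ :=
  ⨆ x : curves N θ q₁ q₂ j, ∫ t in (q₁ : ℝ)..q₂, ‖f t (x.1 t)‖

/-- The topology on a set `X` of functions generated by the balls, centred at points of `X`, of a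
family of seminorms `p q₁ q₂ j` with `q₁ < q₂` rational and `j` natural. -/
@[reducible] def seminormTopology (X : Set (ℝ → E N → V)) (p : ℚ → ℚ → ℕ → (ℝ → E N → V) → ℝ) :
    TopologicalSpace X :=
  TopologicalSpace.generateFrom
    {U | ∃ (q₁ q₂ : ℚ) (j : ℕ) (c : X) (ε : ℝ), q₁ < q₂ ∧ 0 < ε ∧
      U = {h : X | p q₁ q₂ j (fun t x => h.1 t x - c.1 t x) < ε}}

/-- Time translation: `(translate t f) s x = f (s + t) x`. -/
def translate (t : ℝ) (f : ℝ → E N → V) : ℝ → E N → V := fun s x => f (s + t) x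

/-! ### Boundedness and equicontinuity of `m`-bounds -/

/-- `L¹_loc`-boundedness of a set of functions. -/
def L1locBounded (S : Set (ℝ → ℝ)) : Prop :=
  ∀ r : ℝ, 0 < r → ∃ C : ℝ, ∀ m ∈ S, ∫ t in (-r)..r, m t ≤ C

/-- `L¹_loc`-equicontinuity of a set of functions. -/
def L1locEquicontinuous (S : Set (ℝ → ℝ)) : Prop :=
  ∀ r : ℝ, 0 < r → ∀ ε : ℝ, 0 < ε → ∃ δ : ℝ, 0 < δ ∧
    ∀ s t : ℝ, -r ≤ s → s ≤ t → t ≤ r → t - s < δ → ∀ m ∈ S, ∫ u in s..t, m u < ε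

/-- For every ball `B_j` there is a set of `m`-bounds on `B_j` of the functions in `X`, with at
least one `m`-bound for each of them, that has the property `Q`. -/
def SetHasMBounds (Q : Set (ℝ → ℝ) → Prop) (X : Set (ℝ → E N → V)) : Prop :=
  ∀ j : ℕ, ∃ S : Set (ℝ → ℝ),
    (∀ m ∈ S, ∃ f ∈ X, IsMBound f (Metric.closedBall 0 (j : ℝ)) m) ∧
    (∀ f ∈ X, ∃ m ∈ S, IsMBound f (Metric.closedBall 0 (j : ℝ)) m) ∧ Q S

/-- `f` has `L¹_loc`-bounded `m`-bounds: the set of all its time translates has. -/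
def HasBoundedMBounds (f : ℝ → E N → V) : Prop :=
  SetHasMBounds L1locBounded (range fun t : ℝ => translate t f)

/-- `f` has `L¹_loc`-equicontinuous `m`-bounds: the set of all its time translates has. -/
def HasEquicontinuousMBounds (f : ℝ → E N → V) : Prop :=
  SetHasMBounds L1locEquicontinuous (range fun t : ℝ => translate t f)

/-- The optimal `m`-bound of `f` on the closed ball of radius `j`. -/
def optimalMBound (f : ℝ → E N → V) (j : ℕ) (t : ℝ) : ℝ :=
  ⨆ x : Metric.closedBall (0 : E N) (j : ℝ), ‖f t x.1‖

/-- The moduli of continuity `θ_j(s) = sup_t ∫_t^{t+s} m^j` given by the optimal `m`-bounds. -/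
def theta (f : ℝ → E N → V) (j : ℕ) (s : ℝ) : ℝ :=
  ⨆ t : ℝ, ∫ u in t..(t + s), optimalMBound f j u

end Classes

/-! ### Hulls and the base space -/

section Base

variable {N : ℕ}

/-- `F` is (a strong Carathéodory representative of) the Jacobian of `f` with respect to `x`; in
particular `f t` is continuously differentiable for almost every `t`. -/
def IsJacobian (f : ℝ → E N → E N) (F : ℝ → E N → L N) : Prop :=
  F ∈ SC N (L N) ∧ ∀ᵐ t : ℝ, ∀ x, HasFDerivAt (f t) (F t x) x

/-- The set of pairs in `X × Y` lying in the closure, for the product topology, of the set of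
simultaneous time translates of `(f, F)`. -/
def hull (X : Set (ℝ → E N → E N)) (Y : Set (ℝ → E N → L N))
    (τX : TopologicalSpace X) (τY : TopologicalSpace Y)
    (f : ℝ → E N → E N) (F : ℝ → E N → L N) : Set (X × Y) :=
  @closure (X × Y) (@instTopologicalSpaceProd X Y τX τY)
    {p : X × Y | ∃ t : ℝ, p.1.1 = translate t f ∧ p.2.1 = translate t F}

/-- The hull of `(f, F)` in `(LC × TC, 𝒯_Θ × 𝒯_Θ)`, `Θ` being given by the `m`-bounds of `f`. -/
def hullStrong (f : ℝ → E N → E N) (F : ℝ → E N → L N) :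
    Set (LC N (E N) × TC N (L N) (theta f)) :=
  hull _ _ (seminormTopology _ (pStrong (theta f))) (seminormTopology _ (pStrong (theta f))) f F

/-- The hull of `(f, F)` in `(LC × WTC, σ_Θ × σ_Θ)`, `Θ` being given by the `m`-bounds of `f`. -/
def hullSigma (f : ℝ → E N → E N) (F : ℝ → E N → L N) :
    Set (LC N (E N) × WTC N (L N) (theta f)) :=
  hull _ _ (seminormTopology _ (pSigma (theta f))) (seminormTopology _ (pSigma (theta f))) f F

/-- Triples `ω = (g, G, x₀)`. -/
abbrev Triple (N : ℕ) : Type := (ℝ → E N → E N) × (ℝ → E N → L N) × E N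

/-- `Ω = ℍ_𝒯 × ℝ^N`. -/
def OmegaStrong (f : ℝ → E N → E N) (F : ℝ → E N → L N) : Set (Triple N) :=
  {ω | ∃ p ∈ hullStrong f F, ω.1 = p.1.1 ∧ ω.2.1 = p.2.1}

/-- `Ω = ℍ_σ × ℝ^N`. -/
def OmegaSigma (f : ℝ → E N → E N) (F : ℝ → E N → L N) : Set (Triple N) :=
  {ω | ∃ p ∈ hullSigma f F, ω.1 = p.1.1 ∧ ω.2.1 = p.2.1}

/-! ### Solutions, the flow on the base, and the coefficient matrix -/

/-- `x` is a Carathéodory solution, defined on all of `ℝ`, of `ẋ = g(t, x)`, `x(0) = x₀`. -/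
def IsGlobalSolution (g : ℝ → E N → E N) (x₀ : E N) (x : ℝ → E N) : Prop :=
  Continuous x ∧ (∀ a b : ℝ, IntervalIntegrable (fun s => g s (x s)) volume a b) ∧
    ∀ t : ℝ, x t = x₀ + ∫ s in (0 : ℝ)..t, g s (x s)

/-- `x(·, g, x₀)` is globally defined. -/
def GloballyDefined (g : ℝ → E N → E N) (x₀ : E N) : Prop :=
  ∃ x, IsGlobalSolution g x₀ x

open Classical in
/-- The solution `x(·, g, x₀)` (only used when it is globally defined; it is unique for
`g ∈ LC`). -/
def sol (g : ℝ → E N → E N) (x₀ : E N) : ℝ → E N :=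
  if h : GloballyDefined g x₀ then h.choose else fun _ => 0

/-- The flow on the base: `ω_t = (g_t, G_t, x(t, g, x₀))`. -/
def baseFlow (ω : Triple N) (t : ℝ) : Triple N :=
  (translate t ω.1, translate t ω.2.1, sol ω.1 ω.2.2 t)

open Classical in
/-- `A(ω) = lim_{h → 0} (1/h) ∫_0^h G(s, x(s, g, x₀)) ds` if the limit exists, and `0` otherwise. -/
def coeff (ω : Triple N) : L N :=
  if h : ∃ B : L N, Tendsto
      (fun h : ℝ => h⁻¹ • ∫ s in (0 : ℝ)..h, ω.2.1 s (sol ω.1 ω.2.2 s)) (𝓝[≠] 0) (𝓝 B)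
  then h.choose else 0

/-! ### Linear systems: bounded growth, exponential dichotomy, dichotomy spectrum -/

/-- `Φ` is the fundamental matrix solution of `ẏ = A(t) y` with `Φ(0) = I` (in the sense of
Carathéodory). -/
def IsFundamental (A : ℝ → L N) (Φ : ℝ → (L N)ˣ) : Prop :=
  (∀ a b : ℝ, IntervalIntegrable (fun s => A s * (Φ s : L N)) volume a b) ∧
    ∀ t : ℝ, (Φ t : L N) = 1 + ∫ s in (0 : ℝ)..t, A s * (Φ s : L N)

/-- The system `ẏ = A(t) y` has bounded growth. -/
def HasBoundedGrowth (A : ℝ → L N) : Prop :=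
  ∃ Φ : ℝ → (L N)ˣ, IsFundamental A Φ ∧
    ∃ K α : ℝ, 1 ≤ K ∧ 0 ≤ α ∧
      ∀ t s : ℝ, ‖(Φ t : L N) * ((Φ s)⁻¹ : (L N)ˣ)‖ ≤ K * Real.exp (α * |t - s|)

/-- The system `ẏ = A(t) y` has exponential dichotomy (on `ℝ`). -/
def HasExpDichotomy (A : ℝ → L N) : Prop :=
  ∃ Φ : ℝ → (L N)ˣ, IsFundamental A Φ ∧
    ∃ P : L N, P * P = P ∧ ∃ K α : ℝ, 1 ≤ K ∧ 0 < α ∧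
      (∀ t s : ℝ, s ≤ t →
        ‖(Φ t : L N) * P * ((Φ s)⁻¹ : (L N)ˣ)‖ ≤ K * Real.exp (-α * (t - s))) ∧
      (∀ t s : ℝ, t ≤ s →
        ‖(Φ t : L N) * (1 - P) * ((Φ s)⁻¹ : (L N)ˣ)‖ ≤ K * Real.exp (α * (t - s)))

/-- The dichotomy spectrum of `ẏ = A(t) y`. -/
def dichotomySpectrum (A : ℝ → L N) : Set ℝ :=
  {γ | ¬ HasExpDichotomy fun t => A t - γ • (1 : L N)}

end Base

end

end Carath

/-!
The norm of `G(u, x(u))` has bounded integrals over intervals of unit length, because the bounded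
solution `x` stays in one ball, on which the translates of `G` have `L¹_loc`-bounded `m`-bounds. The
Peano–Baker series bounds the evolution from time `s` to time `t` by the exponential of the
integral of the norm of the coefficient, which is therefore at most affine in `|t - s|`: this is
bounded growth.

If `γ₁ ≤ γ₂` lie in the resolvent set, with dichotomy projections `P₁`, `P₂`, then
`Φ(t) P₁ Φ(s)⁻¹` grows more slowly than `Φ(t) (1 - P₂) Φ(s)⁻¹`, which forces
`P₁ P₂ = P₁ = P₂ P₁`. Hence the rank of the projection increases with `γ`, and where it does not
change neither does the projection. So the `γ` at which the rank is `n` form an open interval,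
and these `N + 1` intervals are ordered by `n`. By bounded growth the rank is `0` near `-∞` and `N`
near `+∞`, so the spectrum consists of the at most `N` compact gaps between successive nonempty
intervals. There is at least one gap since `ℝ` is connected.
-/

namespace Carath

section AbsoluteContinuity

variable {V : Type*} [NormedAddCommGroup V] {f : ℝ → V} {a b : ℝ}

theorem intervalIntegrable_of_locallyIntegrable (hf : LocallyIntegrable f) (a b : ℝ) :
    IntervalIntegrable f volume a b :=
  intervalIntegrable_iff.2
    ((hf.integrableOn_isCompact isCompact_uIcc).mono_set uIoc_subset_uIcc)

theorem locallyIntegrable_iff_forall_intervalIntegrable :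
    LocallyIntegrable f ↔ ∀ a b, IntervalIntegrable f volume a b :=
  ⟨intervalIntegrable_of_locallyIntegrable, fun hf x =>
    ⟨Ioc (x - 1) (x + 1), Ioc_mem_nhds (by linarith) (by linarith),
      (intervalIntegrable_iff_integrableOn_Ioc_of_le (by linarith)).1 (hf _ _)⟩⟩

theorem absolutelyContinuousOnInterval_of_dist_le {W : Type*} [PseudoMetricSpace W]
    {u : ℝ → W} {v : ℝ → ℝ} (hv : AbsolutelyContinuousOnInterval v a b)
    (h : ∀ x ∈ uIcc a b, ∀ y ∈ uIcc a b, dist (u x) (u y) ≤ dist (v x) (v y)) :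
    AbsolutelyContinuousOnInterval u a b := by
  rw [absolutelyContinuousOnInterval_iff] at hv ⊢
  refine fun ε hε => (hv ε hε).imp fun δ hδ => ⟨hδ.1, fun E hE hlt => ?_⟩
  exact (Finset.sum_le_sum fun i hi => h _ (hE.1 i hi).1 _ (hE.1 i hi).2).trans_lt
    (hδ.2 E hE hlt)

variable [NormedSpace ℝ V]

theorem absolutelyContinuousOnInterval_primitive (hf : IntervalIntegrable f volume a b) {c : ℝ}
    (hc : c ∈ uIcc a b) : AbsolutelyContinuousOnInterval (fun t => ∫ r in c..t, f r) a b := by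
  refine absolutelyContinuousOnInterval_of_dist_le
    (hf.norm.absolutelyContinuousOnInterval_intervalIntegral hc) fun x hx y hy => ?_
  have hfc : ∀ z ∈ uIcc a b, IntervalIntegrable f volume c z := fun z hz =>
    hf.mono_set (uIcc_subset_uIcc hc hz)
  rw [dist_eq_norm, dist_eq_norm,
    intervalIntegral.integral_interval_sub_left (hfc x hx) (hfc y hy),
    intervalIntegral.integral_interval_sub_left (hfc x hx).norm (hfc y hy).norm]
  exact intervalIntegral.norm_integral_le_abs_integral_norm

theorem integral_eq_sub_of_absolutelyContinuousOnInterval [CompleteSpace V] {u : ℝ → V}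
    (hu : AbsolutelyContinuousOnInterval u a b) (hf : IntervalIntegrable f volume a b)
    (hd : ∀ᵐ x, x ∈ uIcc a b → HasDerivAt u (f x) x) : ∫ t in a..b, f t = u b - u a := by
  obtain ⟨C, hC⟩ := (hu.sub
    (absolutelyContinuousOnInterval_primitive hf left_mem_uIcc)).const_of_ae_hasDerivAt_zero (by
      filter_upwards [hd, hf.ae_hasDerivAt_integral] with x hux hfx hx
      simpa using (hux hx).sub (hfx hx a left_mem_uIcc))
  have ha : u a - ∫ t in a..a, f t = C := hC a left_mem_uIcc
  have hb : u b - ∫ t in a..b, f t = C := hC b right_mem_uIcc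
  rw [intervalIntegral.integral_same, sub_zero] at ha
  rw [ha, ← hb, sub_sub_cancel]

theorem absolutelyContinuousOnInterval_pow {M : ℝ → ℝ}
    (hM : AbsolutelyContinuousOnInterval M a b) (n : ℕ) :
    AbsolutelyContinuousOnInterval (fun t => M t ^ n) a b := by
  induction n with
  | zero => simpa only [pow_zero] using ContDiffOn.absolutelyContinuousOnInterval contDiffOn_const
  | succ n ih => simpa only [pow_succ] using ih.fun_mul hM

theorem integral_mul_primitive_pow {w : ℝ → ℝ} (hw : IntervalIntegrable w volume a b) (n : ℕ) :
    ∫ r in a..b, w r * (∫ v in a..r, w v) ^ n = (∫ v in a..b, w v) ^ (n + 1) / (n + 1) := by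
  have hM : ContinuousOn (fun r => ∫ v in a..r, w v) (uIcc a b) :=
    intervalIntegral.continuousOn_primitive_interval' hw left_mem_uIcc
  have hderiv : ∀ᵐ x, x ∈ uIcc a b → HasDerivAt (fun r => (∫ v in a..r, w v) ^ (n + 1))
      ((n + 1) * (w x * (∫ v in a..x, w v) ^ n)) x := by
    filter_upwards [hw.ae_hasDerivAt_integral] with x hx hxab
    convert! (hx hxab a left_mem_uIcc).pow (n + 1) using 1
    push_cast
    ring
  have ftc := integral_eq_sub_of_absolutelyContinuousOnInterval
    (absolutelyContinuousOnInterval_pow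
      (absolutelyContinuousOnInterval_primitive hw left_mem_uIcc) (n + 1))
    ((hw.mul_continuousOn (hM.fun_pow n)).const_mul _) hderiv
  rw [intervalIntegral.integral_const_mul, intervalIntegral.integral_same,
    zero_pow n.succ_ne_zero, sub_zero] at ftc
  rw [← ftc, mul_div_cancel_left₀ _ n.cast_add_one_ne_zero]

theorem exists_abs_primitive_eq_mul {w : ℝ → ℝ} (hw : ∀ r, 0 ≤ w r) (a b : ℝ) :
    ∃ ε : ℝ, |ε| = 1 ∧ ∀ r ∈ uIcc a b, |∫ v in a..r, w v| = ε * ∫ v in a..r, w v := by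
  rcases le_total a b with hab | hab
  · refine ⟨1, abs_one, fun r hr => ?_⟩
    rw [uIcc_of_le hab] at hr
    rw [one_mul, abs_of_nonneg (intervalIntegral.integral_nonneg hr.1 fun v _ => hw v)]
  · refine ⟨-1, by simp, fun r hr => ?_⟩
    rw [uIcc_of_ge hab] at hr
    rw [neg_one_mul, intervalIntegral.integral_symm, abs_neg, neg_neg,
      abs_of_nonneg (intervalIntegral.integral_nonneg hr.2 fun v _ => hw v)]

theorem abs_integral_mul_abs_primitive_pow {w : ℝ → ℝ} (hw : IntervalIntegrable w volume a b)
    (hw0 : ∀ r, 0 ≤ w r) (n : ℕ) :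
    |∫ r in a..b, w r * |∫ v in a..r, w v| ^ n| = |∫ v in a..b, w v| ^ (n + 1) / (n + 1) := by
  obtain ⟨ε, hε, hsign⟩ := exists_abs_primitive_eq_mul hw0 a b
  have hpull : ∫ r in a..b, w r * |∫ v in a..r, w v| ^ n =
      ε ^ n * ∫ r in a..b, w r * (∫ v in a..r, w v) ^ n := by
    rw [← intervalIntegral.integral_const_mul]
    refine intervalIntegral.integral_congr fun r hr => ?_
    simp only [hsign r hr, mul_pow]
    ring
  rw [hpull, abs_mul, abs_pow, hε, one_pow, one_mul, integral_mul_primitive_pow hw, abs_div,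
    abs_pow, abs_of_nonneg (by positivity : (0 : ℝ) ≤ n + 1)]

theorem norm_integral_le_of_norm_le_mul_primitive_pow {w : ℝ → ℝ} {C : ℝ} {n : ℕ}
    (hw : IntervalIntegrable w volume a b) (hw0 : ∀ r, 0 ≤ w r) (hC : 0 ≤ C)
    (h : ∀ᵐ r, r ∈ uIoc a b → ‖f r‖ ≤ w r * (C * (|∫ v in a..r, w v| ^ n / n.factorial))) :
    ‖∫ r in a..b, f r‖ ≤ C * (|∫ v in a..b, w v| ^ (n + 1) / (n + 1).factorial) := by
  have hM : ContinuousOn (fun r => ∫ v in a..r, w v) (uIcc a b) :=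
    intervalIntegral.continuousOn_primitive_interval' hw left_mem_uIcc
  calc ‖∫ r in a..b, f r‖
      ≤ |∫ r in a..b, w r * |∫ v in a..r, w v| ^ n * (C / n.factorial)| := by
        refine intervalIntegral.norm_integral_le_abs_of_norm_le
          ((ae_restrict_iff' measurableSet_uIoc).2 ?_)
          ((hw.mul_continuousOn (hM.abs.pow n)).mul_const _)
        filter_upwards [h] with r hr hrab
        exact (hr hrab).trans_eq (by ring)
    _ = |∫ v in a..b, w v| ^ (n + 1) / (n + 1) * (C / n.factorial) := by
        rw [intervalIntegral.integral_mul_const, abs_mul, abs_integral_mul_abs_primitive_pow hw hw0,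
          abs_of_nonneg (by positivity : 0 ≤ C / n.factorial)]
    _ = C * (|∫ v in a..b, w v| ^ (n + 1) / (n + 1).factorial) := by
        rw [Nat.factorial_succ]
        push_cast
        field_simp

theorem eq_zero_of_eq_integral_of_norm_le_mul {u : ℝ → V} {w : ℝ → ℝ}
    (hu : ContinuousOn u (uIcc a b)) (hw : IntervalIntegrable w volume a b) (hw0 : ∀ r, 0 ≤ w r)
    (huf : ∀ t ∈ uIcc a b, u t = ∫ r in a..t, f r)
    (hf : ∀ᵐ r, r ∈ uIoc a b → ‖f r‖ ≤ w r * ‖u r‖) : u b = 0 := by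
  obtain ⟨C, hC⟩ := isCompact_uIcc.exists_bound_of_continuousOn hu
  have hC0 : 0 ≤ C := (norm_nonneg _).trans (hC a left_mem_uIcc)
  -- Each use of `‖u t‖ ≤ |∫ w ‖u‖|` gains one factor of the primitive of `w`.
  have hiter : ∀ n : ℕ, ∀ t ∈ uIcc a b,
      ‖u t‖ ≤ C * (|∫ v in a..t, w v| ^ n / n.factorial) := by
    intro n
    induction n with
    | zero => simpa using hC
    | succ n ih =>
      intro t ht
      have hsub : uIcc a t ⊆ uIcc a b := uIcc_subset_uIcc_left ht
      rw [huf t ht]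
      refine norm_integral_le_of_norm_le_mul_primitive_pow (hw.mono_set hsub) hw0 hC0 ?_
      filter_upwards [hf] with r hr hrt
      have hrb : r ∈ uIoc a b := uIoc_subset_uIoc_of_uIcc_subset_uIcc hsub hrt
      exact (hr hrb).trans
        (mul_le_mul_of_nonneg_left (ih r (uIoc_subset_uIcc hrb)) (hw0 r))
  have hlim : Tendsto (fun n : ℕ => C * (|∫ v in a..b, w v| ^ n / n.factorial)) atTop (𝓝 0) := by
    simpa only [mul_zero] using (FloorSemiring.tendsto_pow_div_factorial_atTop _).const_mul C
  exact norm_le_zero_iff.1 (ge_of_tendsto' hlim fun n => hiter n b right_mem_uIcc)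

end AbsoluteContinuity

section CaratheodorySolutions

variable {V : Type*} [NormedAddCommGroup V] [NormedSpace ℝ V] {v : ℝ → V → V} {x y : ℝ → V}

/-- `x : ℝ → V` is a Carathéodory solution, defined on all of `ℝ`, of `ẋ = v(t, x)`. Being free of
an initial condition, the notion covers nonlinear equations and linear matrix systems alike. -/
def IsCaratheodorySolution (v : ℝ → V → V) (x : ℝ → V) : Prop :=
  LocallyIntegrable (fun r => v r (x r)) ∧ ∀ s t : ℝ, x t - x s = ∫ r in s..t, v r (x r)

theorem isCaratheodorySolution_iff_eq_add_integral (s : ℝ) :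
    IsCaratheodorySolution v x ↔
      LocallyIntegrable (fun r => v r (x r)) ∧ ∀ t, x t = x s + ∫ r in s..t, v r (x r) := by
  refine and_congr_right fun hv => ⟨fun h t => by rw [← h, add_sub_cancel], fun h a b => ?_⟩
  have hi := intervalIntegrable_of_locallyIntegrable hv
  rw [h a, h b, add_sub_add_left_eq_sub,
    intervalIntegral.integral_interval_sub_left (hi _ _) (hi _ _)]

theorem IsCaratheodorySolution.continuous (hx : IsCaratheodorySolution v x) : Continuous x := by
  rw [funext ((isCaratheodorySolution_iff_eq_add_integral 0).1 hx).2]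
  exact continuous_const.add
    (intervalIntegral.continuous_primitive (intervalIntegrable_of_locallyIntegrable hx.1) 0)

theorem IsCaratheodorySolution.absolutelyContinuousOnInterval (hx : IsCaratheodorySolution v x)
    (a b : ℝ) : AbsolutelyContinuousOnInterval x a b := by
  rw [funext ((isCaratheodorySolution_iff_eq_add_integral a).1 hx).2]
  exact (LipschitzWith.const (x a)).lipschitzOnWith.absolutelyContinuousOnInterval.fun_add
    (absolutelyContinuousOnInterval_primitive
      (intervalIntegrable_of_locallyIntegrable hx.1 a b) left_mem_uIcc)

theorem IsCaratheodorySolution.ae_hasDerivAt [CompleteSpace V] (hx : IsCaratheodorySolution v x) :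
    ∀ᵐ t, HasDerivAt x (v t (x t)) t := by
  filter_upwards [LocallyIntegrable.ae_hasDerivAt_integral hx.1] with t ht
  exact ((ht 0).const_add (x 0)).congr_of_eventuallyEq
    (Eventually.of_forall ((isCaratheodorySolution_iff_eq_add_integral 0).1 hx).2)

theorem IsCaratheodorySolution.comp_add_right (hx : IsCaratheodorySolution v x) (c : ℝ) :
    IsCaratheodorySolution (fun s => v (s + c)) fun s => x (s + c) := by
  refine ⟨locallyIntegrable_iff_forall_intervalIntegrable.2 fun a b => ?_, fun s t => ?_⟩
  · simpa using
      (intervalIntegrable_of_locallyIntegrable hx.1 (a + c) (b + c)).comp_add_right c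
  · rw [hx.2, intervalIntegral.integral_comp_add_right (fun r => v r (x r))]

theorem IsCaratheodorySolution.eq_of_eq_at (hx : IsCaratheodorySolution v x)
    (hy : IsCaratheodorySolution v y)
    (hlip : ∀ a b : ℝ, ∃ l : ℝ → ℝ, IntervalIntegrable l volume a b ∧
      ∀ᵐ r, r ∈ uIoc a b → ‖v r (x r) - v r (y r)‖ ≤ l r * ‖x r - y r‖)
    {s : ℝ} (hs : x s = y s) : x = y := by
  funext t
  obtain ⟨l, hl, hvl⟩ := hlip s t
  refine sub_eq_zero.1 (eq_zero_of_eq_integral_of_norm_le_mul (u := x - y) (a := s) (b := t)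
    (f := fun r => v r (x r) - v r (y r)) (w := fun r => |l r|)
    (hx.continuous.sub hy.continuous).continuousOn hl.abs (fun r => abs_nonneg _)
    (fun r _ => ?_) ?_)
  · rw [intervalIntegral.integral_sub (intervalIntegrable_of_locallyIntegrable hx.1 _ _)
      (intervalIntegrable_of_locallyIntegrable hy.1 _ _), ← hx.2, ← hy.2, hs, Pi.sub_apply,
      sub_sub_sub_cancel_right]
  · filter_upwards [hvl] with r hr hrst
    exact (hr hrst).trans (mul_le_mul_of_nonneg_right (le_abs_self _) (norm_nonneg _))

end CaratheodorySolutions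

section LinearSystems

variable {R : Type*} [NormedRing R] [NormedAlgebra ℝ R] {A : ℝ → R} {Y Z : ℝ → R}

theorem IsCaratheodorySolution.mul_const [CompleteSpace R]
    (hY : IsCaratheodorySolution (fun t X => A t * X) Y) (C : R) :
    IsCaratheodorySolution (fun t X => A t * X) fun t => Y t * C := by
  simp only [IsCaratheodorySolution, ← mul_assoc]
  refine ⟨hY.1.mul_continuous continuous_const, fun s t => ?_⟩
  rw [← sub_mul, hY.2]
  exact (((ContinuousLinearMap.mul ℝ R).flip C).intervalIntegral_comp_comm
    (intervalIntegrable_of_locallyIntegrable hY.1 s t)).symm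

theorem IsCaratheodorySolution.eq_of_eq_at_of_linear (hA : LocallyIntegrable A)
    (hY : IsCaratheodorySolution (fun t X => A t * X) Y)
    (hZ : IsCaratheodorySolution (fun t X => A t * X) Z) {s : ℝ} (hs : Y s = Z s) : Y = Z := by
  refine hY.eq_of_eq_at hZ (fun a b => ⟨fun r => ‖A r‖,
    (intervalIntegrable_of_locallyIntegrable hA a b).norm, ae_of_all _ fun r _ => ?_⟩) hs
  rw [← mul_sub]
  exact norm_mul_le _ _

theorem IsCaratheodorySolution.exp_smul [CompleteSpace R]
    (hY : IsCaratheodorySolution (fun t X => A t * X) Y) (c : ℝ) :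
    IsCaratheodorySolution (fun t X => (A t + c • (1 : R)) * X)
      fun t => Real.exp (c * t) • Y t := by
  have hexp : Continuous fun t : ℝ => Real.exp (c * t) := by fun_prop
  have hint : LocallyIntegrable fun t => (A t + c • (1 : R)) * Real.exp (c * t) • Y t := by
    simp only [add_mul, smul_one_mul, mul_smul_comm]
    exact LocallyIntegrable.continuous_smul hexp
      (LocallyIntegrable.add hY.1 (hY.continuous.const_smul c).locallyIntegrable)
  refine ⟨hint, fun s t => Eq.symm (integral_eq_sub_of_absolutelyContinuousOnInterval
    (u := fun t => Real.exp (c * t) • Y t) ?_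
    (intervalIntegrable_of_locallyIntegrable hint s t) ?_)⟩
  · have hexp_ac : AbsolutelyContinuousOnInterval (fun t : ℝ => Real.exp (c * t)) s t :=
      ContDiffOn.absolutelyContinuousOnInterval (by fun_prop)
    exact hexp_ac.fun_smul (hY.absolutelyContinuousOnInterval s t)
  · filter_upwards [hY.ae_hasDerivAt] with r hr _
    convert! ((hasDerivAt_id r).const_mul c).exp.smul hr using 1
    simp only [add_mul, smul_one_mul, mul_smul_comm, id]
    module

/-- The terms of the Peano–Baker series: the Picard iterates for `Ẋ = A(t) X`, `X(s) = 1`, are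
its partial sums. -/
noncomputable def peanoBakerTerm (A : ℝ → R) (s : ℝ) : ℕ → ℝ → R
  | 0 => fun _ => 1
  | n + 1 => fun t => ∫ r in s..t, A r * peanoBakerTerm A s n r

theorem continuous_peanoBakerTerm (hA : LocallyIntegrable A) (s : ℝ) (n : ℕ) :
    Continuous (peanoBakerTerm A s n) := by
  induction n with
  | zero => exact continuous_const
  | succ n ih =>
    exact intervalIntegral.continuous_primitive
      (intervalIntegrable_of_locallyIntegrable (hA.mul_continuous ih)) s

theorem norm_peanoBakerTerm_le (hA : LocallyIntegrable A) (s : ℝ) (n : ℕ) (t : ℝ) :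
    ‖peanoBakerTerm A s n t‖ ≤ ‖(1 : R)‖ * (|∫ r in s..t, ‖A r‖| ^ n / n.factorial) := by
  induction n generalizing t with
  | zero => simp [peanoBakerTerm]
  | succ n ih =>
    refine norm_integral_le_of_norm_le_mul_primitive_pow
      (intervalIntegrable_of_locallyIntegrable hA s t).norm (fun r => norm_nonneg _)
      (norm_nonneg _) (ae_of_all _ fun r _ => ?_)
    exact (norm_mul_le _ _).trans (mul_le_mul_of_nonneg_left (ih r) (norm_nonneg _))

theorem exists_norm_peanoBakerTerm_le_on_uIcc (hA : LocallyIntegrable A) (s a b : ℝ) :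
    ∃ c : ℝ, ∀ t ∈ uIcc a b, ∀ n,
      ‖peanoBakerTerm A s n t‖ ≤ ‖(1 : R)‖ * (c ^ n / n.factorial) := by
  have hM : Continuous fun t => |∫ r in s..t, ‖A r‖| :=
    (intervalIntegral.continuous_primitive
      (fun a b => (intervalIntegrable_of_locallyIntegrable hA a b).norm) s).abs
  obtain ⟨c, hc⟩ := (isCompact_uIcc (a := a) (b := b)).bddAbove_image hM.continuousOn
  refine ⟨c, fun t ht n => (norm_peanoBakerTerm_le hA s n t).trans ?_⟩
  have : |∫ r in s..t, ‖A r‖| ≤ c := hc (mem_image_of_mem _ ht)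
  gcongr

theorem hasSum_mul_pow_div_factorial (c x : ℝ) :
    HasSum (fun n : ℕ => c * (x ^ n / n.factorial)) (c * Real.exp x) := by
  rw [Real.exp_eq_exp_ℝ]
  exact (NormedSpace.expSeries_div_hasSum_exp x).mul_left c

/-- The sum of the Peano–Baker series: as a function of `t`, the solution of `Ẋ = A(t) X` with
`X(s) = 1`, that is, the evolution operator from time `s` to time `t`. -/
noncomputable def evolution (A : ℝ → R) (s t : ℝ) : R := ∑' n, peanoBakerTerm A s n t

theorem norm_evolution_le (hA : LocallyIntegrable A) (s t : ℝ) :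
    ‖evolution A s t‖ ≤ ‖(1 : R)‖ * Real.exp |∫ r in s..t, ‖A r‖| :=
  tsum_of_norm_bounded (hasSum_mul_pow_div_factorial _ _) (norm_peanoBakerTerm_le hA s · t)

theorem evolution_self (s : ℝ) : evolution A s s = 1 := by
  rw [evolution, tsum_eq_single 0]
  · rfl
  · rintro (_ | n) hn
    · exact absurd rfl hn
    · exact intervalIntegral.integral_same

/-- The fundamental solution `e^{ct} Φ(t)` of the system with coefficient `A(t) + c` in place
of `A(t)`. -/
noncomputable def expShift (Φ : ℝ → Rˣ) (c t : ℝ) : Rˣ :=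
  Units.mk0 (Real.exp (c * t)) (Real.exp_ne_zero _) • Φ t

theorem val_expShift (Φ : ℝ → Rˣ) (c t : ℝ) :
    (expShift Φ c t : R) = Real.exp (c * t) • (Φ t : R) :=
  rfl

theorem norm_expShift_mul_mul_inv (Φ : ℝ → Rˣ) (c t s : ℝ) (P : R) :
    ‖(expShift Φ c t : R) * P * ((expShift Φ c s)⁻¹ : Rˣ)‖ =
      Real.exp (c * (t - s)) * ‖(Φ t : R) * P * ((Φ s)⁻¹ : Rˣ)‖ := by
  have hinv : (((expShift Φ c s)⁻¹ : Rˣ) : R) = Real.exp (-(c * s)) • ((Φ s)⁻¹ : Rˣ) := by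
    rw [Real.exp_neg]
    rfl
  rw [val_expShift, hinv, smul_mul_assoc, smul_mul_smul_comm, ← Real.exp_add, norm_smul,
    Real.norm_eq_abs, Real.abs_exp, mul_sub, sub_eq_add_neg]

theorem expShift_zero (Φ : ℝ → Rˣ) (c : ℝ) : expShift Φ c 0 = Φ 0 :=
  Units.ext (by rw [val_expShift, mul_zero, Real.exp_zero, one_smul])

variable [CompleteSpace R]

theorem hasSum_peanoBakerTerm (hA : LocallyIntegrable A) (s t : ℝ) :
    HasSum (peanoBakerTerm A s · t) (evolution A s t) :=
  (Summable.of_norm_bounded (hasSum_mul_pow_div_factorial _ _).summable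
    (norm_peanoBakerTerm_le hA s · t)).hasSum

theorem continuous_evolution (hA : LocallyIntegrable A) (s : ℝ) : Continuous (evolution A s) := by
  refine continuous_iff_continuousAt.2 fun t => ?_
  obtain ⟨c, hc⟩ := exists_norm_peanoBakerTerm_le_on_uIcc hA s (t - 1) (t + 1)
  refine (continuousOn_tsum (fun n => (continuous_peanoBakerTerm hA s n).continuousOn)
    (hasSum_mul_pow_div_factorial _ c).summable (fun n r hr => hc r hr n)).continuousAt ?_
  rw [uIcc_of_le (by linarith)]
  exact Icc_mem_nhds (by linarith) (by linarith)

theorem hasSum_integral_mul_peanoBakerTerm (hA : LocallyIntegrable A) (s t : ℝ) :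
    HasSum (fun n => ∫ r in s..t, A r * peanoBakerTerm A s n r)
      (∫ r in s..t, A r * evolution A s r) := by
  obtain ⟨c, hc⟩ := exists_norm_peanoBakerTerm_le_on_uIcc hA s s t
  refine intervalIntegral.hasSum_integral_of_dominated_convergence
    (fun n r => ‖A r‖ * (‖(1 : R)‖ * (c ^ n / n.factorial))) (fun n => ?_) (fun n => ?_) ?_ ?_ ?_
  · exact (intervalIntegrable_of_locallyIntegrable
      (hA.mul_continuous (continuous_peanoBakerTerm hA s n)) s t).def'.aestronglyMeasurable
  · exact ae_of_all _ fun r hr => (norm_mul_le _ _).trans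
      (mul_le_mul_of_nonneg_left (hc r (uIoc_subset_uIcc hr) n) (norm_nonneg _))
  · exact ae_of_all _ fun r _ => (hasSum_mul_pow_div_factorial _ c).summable.mul_left _
  · simp only [tsum_mul_left]
    exact (intervalIntegrable_of_locallyIntegrable hA s t).norm.mul_const _
  · exact ae_of_all _ fun r _ => (hasSum_peanoBakerTerm hA s r).mul_left _

theorem isCaratheodorySolution_evolution (hA : LocallyIntegrable A) (s : ℝ) :
    IsCaratheodorySolution (fun t X => A t * X) (evolution A s) := by
  refine (isCaratheodorySolution_iff_eq_add_integral s).2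
    ⟨hA.mul_continuous (continuous_evolution hA s), fun t => ?_⟩
  rw [evolution_self, ← (hasSum_integral_mul_peanoBakerTerm hA s t).tsum_eq]
  exact (hasSum_peanoBakerTerm hA s t).summable.tsum_eq_zero_add

theorem evolution_mul_evolution (hA : LocallyIntegrable A) (r s t : ℝ) :
    evolution A s t * evolution A r s = evolution A r t :=
  congrFun (((isCaratheodorySolution_evolution hA s).mul_const _).eq_of_eq_at_of_linear hA
    (isCaratheodorySolution_evolution hA r) (s := s) (by rw [evolution_self, one_mul])) t

/-- The value at time `t` of the solution of `Ẋ = A(t) X` with `X(0) = 1`, as a unit. -/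
noncomputable def fundamentalSolution (hA : LocallyIntegrable A) (t : ℝ) : Rˣ where
  val := evolution A 0 t
  inv := evolution A t 0
  val_inv := by rw [evolution_mul_evolution hA, evolution_self]
  inv_val := by rw [evolution_mul_evolution hA, evolution_self]

theorem fundamentalSolution_mul_inv (hA : LocallyIntegrable A) (s t : ℝ) :
    (fundamentalSolution hA t : R) * ((fundamentalSolution hA s)⁻¹ : Rˣ) = evolution A s t :=
  evolution_mul_evolution hA s 0 t

end LinearSystems

section FundamentalSolutions

variable {N : ℕ} {A : ℝ → L N} {Φ Ψ : ℝ → (L N)ˣ}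

theorem isFundamental_iff_isCaratheodorySolution :
    IsFundamental A Φ ↔
      IsCaratheodorySolution (fun t X => A t * X) (fun t => (Φ t : L N)) ∧ Φ 0 = 1 := by
  rw [isCaratheodorySolution_iff_eq_add_integral 0, locallyIntegrable_iff_forall_intervalIntegrable]
  refine ⟨fun ⟨hi, h⟩ => ?_, fun ⟨⟨hi, h⟩, h0⟩ => ⟨hi, by simpa only [h0, Units.val_one] using h⟩⟩
  have h0 : Φ 0 = 1 := Units.ext (by simpa using h 0)
  exact ⟨⟨hi, by simpa only [h0, Units.val_one] using h⟩, h0⟩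

theorem IsFundamental.locallyIntegrable (h : IsFundamental A Φ) : LocallyIntegrable A := by
  obtain ⟨hsol, -⟩ := isFundamental_iff_isCaratheodorySolution.1 h
  have hinv : Continuous fun t => (((Φ t)⁻¹ : (L N)ˣ) : L N) := by
    simp only [← Ring.inverse_unit]
    exact continuous_iff_continuousAt.2 fun t =>
      ContinuousAt.comp (f := fun t => (Φ t : L N)) (NormedRing.inverse_continuousAt (Φ t))
        hsol.continuous.continuousAt
  simpa only [mul_assoc, Units.mul_inv, mul_one] using LocallyIntegrable.mul_continuous hinv hsol.1

theorem IsFundamental.unique (hΦ : IsFundamental A Φ) (hΨ : IsFundamental A Ψ) : Φ = Ψ := by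
  have hA := hΦ.locallyIntegrable
  rw [isFundamental_iff_isCaratheodorySolution] at hΦ hΨ
  have hval := hΦ.1.eq_of_eq_at_of_linear hA hΨ.1 (congrArg Units.val (hΦ.2.trans hΨ.2.symm))
  exact funext fun t => Units.ext (congrFun hval t)

theorem isFundamental_fundamentalSolution (hA : LocallyIntegrable A) :
    IsFundamental A (fundamentalSolution hA) :=
  isFundamental_iff_isCaratheodorySolution.2
    ⟨isCaratheodorySolution_evolution hA 0, Units.ext (evolution_self 0)⟩

theorem IsFundamental.sub_smul_one (h : IsFundamental A Φ) (γ : ℝ) :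
    IsFundamental (fun t => A t - γ • (1 : L N)) (expShift Φ (-γ)) := by
  rw [isFundamental_iff_isCaratheodorySolution, expShift_zero] at *
  have hexp := h.1.exp_smul (-γ)
  simp only [neg_smul, ← sub_eq_add_neg] at hexp
  exact ⟨hexp, h.2⟩

end FundamentalSolutions

section BoundedGrowth

theorem integral_add_natCast_le {a : ℝ → ℝ} (ha : LocallyIntegrable a) {C : ℝ}
    (hC : ∀ t, ∫ u in t..t + 1, a u ≤ C) (s : ℝ) (n : ℕ) : ∫ u in s..s + n, a u ≤ n * C := by
  have hai := intervalIntegrable_of_locallyIntegrable ha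
  induction n with
  | zero => simp
  | succ n ih =>
    rw [Nat.cast_succ, ← add_assoc,
      ← intervalIntegral.integral_add_adjacent_intervals (hai s (s + n)) (hai _ _)]
    linarith [hC (s + n)]

theorem abs_integral_le_of_integral_unit_le {a : ℝ → ℝ} (ha : LocallyIntegrable a)
    (ha0 : ∀ t, 0 ≤ a t) {C : ℝ} (hC : ∀ t, ∫ u in t..t + 1, a u ≤ C) (s t : ℝ) :
    |∫ u in s..t, a u| ≤ C * (|t - s| + 1) := by
  wlog hst : s ≤ t generalizing s t
  · rw [intervalIntegral.integral_symm, abs_neg, abs_sub_comm]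
    exact this t s (le_of_not_ge hst)
  have hai := intervalIntegrable_of_locallyIntegrable ha
  have hC0 : 0 ≤ C :=
    (intervalIntegral.integral_nonneg (by linarith) fun u _ => ha0 u).trans (hC 0)
  rw [abs_of_nonneg (intervalIntegral.integral_nonneg hst fun u _ => ha0 u),
    abs_of_nonneg (sub_nonneg.2 hst)]
  calc ∫ u in s..t, a u
      ≤ ∫ u in s..s + (⌈t - s⌉₊ : ℝ), a u :=
        intervalIntegral.integral_mono_interval le_rfl hst (by linarith [Nat.le_ceil (t - s)])
          (ae_of_all _ ha0) (hai _ _)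
    _ ≤ ⌈t - s⌉₊ * C := integral_add_natCast_le ha hC s _
    _ ≤ C * (t - s + 1) := by
        rw [mul_comm]
        exact mul_le_mul_of_nonneg_left (Nat.ceil_lt_add_one (sub_nonneg.2 hst)).le hC0

theorem hasBoundedGrowth_of_integral_norm_le {N : ℕ} {A : ℝ → L N} (hA : LocallyIntegrable A)
    {C : ℝ} (hC : ∀ t, ∫ u in t..t + 1, ‖A u‖ ≤ C) : HasBoundedGrowth A := by
  have hC0 : 0 ≤ C :=
    (intervalIntegral.integral_nonneg (by linarith) fun u _ => norm_nonneg (A u)).trans (hC 0)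
  refine ⟨_, isFundamental_fundamentalSolution hA, Real.exp C, C, Real.one_le_exp hC0, hC0,
    fun t s => ?_⟩
  rw [fundamentalSolution_mul_inv]
  calc ‖evolution A s t‖
      ≤ ‖(1 : L N)‖ * Real.exp |∫ r in s..t, ‖A r‖| := norm_evolution_le hA s t
    _ ≤ Real.exp |∫ r in s..t, ‖A r‖| :=
        mul_le_of_le_one_left (Real.exp_pos _).le ContinuousLinearMap.norm_id_le
    _ ≤ Real.exp (C * (|t - s| + 1)) :=
        Real.exp_le_exp.2 (abs_integral_le_of_integral_unit_le (fun x => (hA x).norm)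
          (fun _ => norm_nonneg _) hC s t)
    _ = Real.exp C * Real.exp (C * |t - s|) := by rw [← Real.exp_add]; ring_nf

end BoundedGrowth

section Dichotomies

variable {R : Type*} [NormedRing R] {Φ : ℝ → Rˣ} {P P₁ P₂ Q : R} {γ γ₁ γ₂ β β' : ℝ}

/-- The evolution `Φ(t) P Φ(s)⁻¹`, for `t ≥ s`, has exponential rate at most `β`. -/
def HasForwardExpBound (Φ : ℝ → Rˣ) (P : R) (β : ℝ) : Prop :=
  ∃ K : ℝ, 1 ≤ K ∧ ∀ t s : ℝ, s ≤ t →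
    ‖(Φ t : R) * P * ((Φ s)⁻¹ : Rˣ)‖ ≤ K * Real.exp (β * (t - s))

/-- The evolution `Φ(t) P Φ(s)⁻¹`, for `t ≤ s`, has exponential rate at least `β`. -/
def HasBackwardExpBound (Φ : ℝ → Rˣ) (P : R) (β : ℝ) : Prop :=
  ∃ K : ℝ, 1 ≤ K ∧ ∀ t s : ℝ, t ≤ s →
    ‖(Φ t : R) * P * ((Φ s)⁻¹ : Rˣ)‖ ≤ K * Real.exp (β * (t - s))

theorem hasForwardExpBound_zero (Φ : ℝ → Rˣ) (β : ℝ) : HasForwardExpBound Φ 0 β :=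
  ⟨1, le_rfl, fun t s _ => by simp only [mul_zero, zero_mul, norm_zero]; positivity⟩

theorem hasBackwardExpBound_zero (Φ : ℝ → Rˣ) (β : ℝ) : HasBackwardExpBound Φ 0 β :=
  ⟨1, le_rfl, fun t s _ => by simp only [mul_zero, zero_mul, norm_zero]; positivity⟩

theorem norm_mul_mul_mul_inv_le (Φ : ℝ → Rˣ) (P Q : R) (r s t : ℝ) :
    ‖(Φ t : R) * (P * Q) * ((Φ r)⁻¹ : Rˣ)‖ ≤
      ‖(Φ t : R) * P * ((Φ s)⁻¹ : Rˣ)‖ * ‖(Φ s : R) * Q * ((Φ r)⁻¹ : Rˣ)‖ := by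
  refine le_of_eq_of_le (congrArg norm ?_) (norm_mul_le _ _)
  simp only [mul_assoc, Units.inv_mul_cancel_left]

theorem eq_zero_of_norm_le_exp {V : Type*} [NormedAddCommGroup V] {v : V} {C : ℝ} (hβ : 0 < β)
    (h : ∀ t : ℝ, 0 ≤ t → ‖v‖ ≤ C * Real.exp (-(β * t))) : v = 0 := by
  have hlim : Tendsto (fun t : ℝ => C * Real.exp (-(β * t))) atTop (𝓝 0) := by
    simpa only [mul_zero, id, Function.comp_def] using Tendsto.const_mul C
      (Real.tendsto_exp_neg_atTop_nhds_zero.comp (tendsto_id.const_mul_atTop hβ))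
  exact norm_le_zero_iff.1 (ge_of_tendsto hlim ((eventually_ge_atTop 0).mono h))

theorem HasForwardExpBound.mul_eq_zero (hP : HasForwardExpBound Φ P β)
    (hQ : HasBackwardExpBound Φ Q β') (hβ : β < β') : P * Q = 0 := by
  obtain ⟨K, -, hP⟩ := hP
  obtain ⟨K', -, hQ⟩ := hQ
  have hconj : (Φ 0 : R) * (P * Q) * ((Φ 0)⁻¹ : Rˣ) = 0 := by
    refine eq_zero_of_norm_le_exp (β := β' - β) (C := K * K') (sub_pos.2 hβ) fun t ht => ?_
    calc _ ≤ _ := norm_mul_mul_mul_inv_le Φ P Q 0 (-t) 0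
      _ ≤ K * Real.exp (β * (0 - -t)) * (K' * Real.exp (β' * (-t - 0))) :=
          mul_le_mul (hP _ _ (by linarith)) (hQ _ _ (by linarith)) (norm_nonneg _)
            ((norm_nonneg _).trans (hP _ _ (by linarith)))
      _ = K * K' * Real.exp (-((β' - β) * t)) := by
          rw [mul_mul_mul_comm, ← Real.exp_add]
          ring_nf
  simpa using hconj

theorem HasBackwardExpBound.mul_eq_zero (hQ : HasBackwardExpBound Φ Q β')
    (hP : HasForwardExpBound Φ P β) (hβ : β < β') : Q * P = 0 := by
  obtain ⟨K, -, hP⟩ := hP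
  obtain ⟨K', -, hQ⟩ := hQ
  have hconj : (Φ 0 : R) * (Q * P) * ((Φ 0)⁻¹ : Rˣ) = 0 := by
    refine eq_zero_of_norm_le_exp (β := β' - β) (C := K' * K) (sub_pos.2 hβ) fun t ht => ?_
    calc _ ≤ _ := norm_mul_mul_mul_inv_le Φ Q P 0 t 0
      _ ≤ K' * Real.exp (β' * (0 - t)) * (K * Real.exp (β * (t - 0))) :=
          mul_le_mul (hQ _ _ ht) (hP _ _ ht) (norm_nonneg _) ((norm_nonneg _).trans (hQ _ _ ht))
      _ = K' * K * Real.exp (-((β' - β) * t)) := by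
          rw [mul_mul_mul_comm, ← Real.exp_add]
          ring_nf
  simpa using hconj

/-- `P` is the projection of an exponential dichotomy of the linear system with fundamental
solution `t ↦ e^{-γt} Φ(t)`. The rates are expressed in terms of `Φ` itself: they are separated
by `γ` instead of `0`. -/
structure IsDichotomyProjection (Φ : ℝ → Rˣ) (γ : ℝ) (P : R) : Prop where
  isIdempotentElem : IsIdempotentElem P
  forward : ∃ β < γ, HasForwardExpBound Φ P β
  backward : ∃ β > γ, HasBackwardExpBound Φ (1 - P) β

theorem IsDichotomyProjection.of_mem_Icc (h₁ : IsDichotomyProjection Φ γ₁ P)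
    (h₂ : IsDichotomyProjection Φ γ₂ P) (hγ : γ ∈ Icc γ₁ γ₂) : IsDichotomyProjection Φ γ P where
  isIdempotentElem := h₁.isIdempotentElem
  forward := h₁.forward.imp fun _ hβ => ⟨hβ.1.trans_le hγ.1, hβ.2⟩
  backward := h₂.backward.imp fun _ hβ => ⟨hγ.2.trans_lt hβ.1, hβ.2⟩

theorem IsDichotomyProjection.eventually_nhds (h : IsDichotomyProjection Φ γ P) :
    ∀ᶠ γ' in 𝓝 γ, IsDichotomyProjection Φ γ' P := by
  obtain ⟨hP, ⟨β, hβ, hfwd⟩, ⟨β', hβ', hbwd⟩⟩ := h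
  filter_upwards [eventually_gt_nhds hβ, eventually_lt_nhds hβ'] with γ' h h'
  exact ⟨hP, ⟨β, h, hfwd⟩, ⟨β', h', hbwd⟩⟩

theorem IsDichotomyProjection.mul_eq_left_of_le (h₁ : IsDichotomyProjection Φ γ₁ P₁)
    (h₂ : IsDichotomyProjection Φ γ₂ P₂) (hγ : γ₁ ≤ γ₂) : P₁ * P₂ = P₁ := by
  obtain ⟨β, hβ, hfwd⟩ := h₁.forward
  obtain ⟨β', hβ', hbwd⟩ := h₂.backward
  have h := hfwd.mul_eq_zero hbwd (hβ.trans (hγ.trans_lt hβ'))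
  rwa [mul_sub, mul_one, sub_eq_zero, eq_comm] at h

theorem IsDichotomyProjection.mul_eq_right_of_le (h₁ : IsDichotomyProjection Φ γ₁ P₁)
    (h₂ : IsDichotomyProjection Φ γ₂ P₂) (hγ : γ₁ ≤ γ₂) : P₂ * P₁ = P₁ := by
  obtain ⟨β, hβ, hfwd⟩ := h₁.forward
  obtain ⟨β', hβ', hbwd⟩ := h₂.backward
  have h := hbwd.mul_eq_zero hfwd (hβ.trans (hγ.trans_lt hβ'))
  rwa [sub_mul, one_mul, sub_eq_zero, eq_comm] at h

theorem isDichotomyProjection_iff_exists_common_rate :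
    IsDichotomyProjection Φ γ P ↔ IsIdempotentElem P ∧ ∃ K α : ℝ, 1 ≤ K ∧ 0 < α ∧
      (∀ t s : ℝ, s ≤ t →
        ‖(Φ t : R) * P * ((Φ s)⁻¹ : Rˣ)‖ ≤ K * Real.exp ((γ - α) * (t - s))) ∧
      (∀ t s : ℝ, t ≤ s →
        ‖(Φ t : R) * (1 - P) * ((Φ s)⁻¹ : Rˣ)‖ ≤ K * Real.exp ((γ + α) * (t - s))) := by
  constructor
  · rintro ⟨hP, ⟨β, hβ, K, hK, hfwd⟩, ⟨β', hβ', K', -, hbwd⟩⟩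
    refine ⟨hP, max K K', min (γ - β) (β' - γ), hK.trans (le_max_left _ _),
      lt_min (sub_pos.2 hβ) (sub_pos.2 hβ'), fun t s hts => (hfwd t s hts).trans ?_,
      fun t s hts => (hbwd t s hts).trans ?_⟩ <;> gcongr ?_ * Real.exp ?_
    · exact le_max_left _ _
    · exact mul_le_mul_of_nonneg_right (by linarith [min_le_left (γ - β) (β' - γ)])
        (sub_nonneg.2 hts)
    · exact le_max_right _ _
    · exact mul_le_mul_of_nonpos_right (by linarith [min_le_right (γ - β) (β' - γ)])
        (sub_nonpos.2 hts)
  · rintro ⟨hP, K, α, hK, hα, hfwd, hbwd⟩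
    exact ⟨hP, ⟨γ - α, by linarith, K, hK, hfwd⟩, ⟨γ + α, by linarith, K, hK, hbwd⟩⟩

theorem norm_expShift_mul_mul_inv_le_iff [NormedAlgebra ℝ R] {K t s : ℝ} :
    ‖(expShift Φ (-γ) t : R) * P * ((expShift Φ (-γ) s)⁻¹ : Rˣ)‖ ≤ K * Real.exp (β * (t - s)) ↔
      ‖(Φ t : R) * P * ((Φ s)⁻¹ : Rˣ)‖ ≤ K * Real.exp ((γ + β) * (t - s)) := by
  rw [norm_expShift_mul_mul_inv, neg_mul, Real.exp_neg, inv_mul_le_iff₀ (Real.exp_pos _),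
    mul_left_comm, ← Real.exp_add, ← add_mul]

theorem IsFundamental.hasExpDichotomy_sub_smul_one_iff {N : ℕ} {A : ℝ → L N}
    {Φ : ℝ → (L N)ˣ} (hΦ : IsFundamental A Φ) (γ : ℝ) :
    HasExpDichotomy (fun t => A t - γ • (1 : L N)) ↔ ∃ P, IsDichotomyProjection Φ γ P := by
  simp only [isDichotomyProjection_iff_exists_common_rate, sub_eq_add_neg γ,
    ← norm_expShift_mul_mul_inv_le_iff]
  refine ⟨fun ⟨Ψ, hΨ, h⟩ => ?_, fun h => ⟨_, hΦ.sub_smul_one γ, h⟩⟩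
  rwa [hΨ.unique (hΦ.sub_smul_one γ)] at h

end Dichotomies

section DichotomyLevels

variable {V : Type*} [NormedAddCommGroup V] [NormedSpace ℝ V] {Φ : ℝ → (V →L[ℝ] V)ˣ}

theorem range_le_range_of_mul_eq_right {P Q : V →L[ℝ] V} (h : Q * P = P) :
    P.range ≤ Q.range := by
  rintro _ ⟨v, rfl⟩
  exact ⟨P v, congrArg (fun T : V →L[ℝ] V => T v) h⟩

theorem IsDichotomyProjection.eq_of_finrank_range_eq [FiniteDimensional ℝ V] {γ₁ γ₂ : ℝ}
    {P₁ P₂ : V →L[ℝ] V} (h₁ : IsDichotomyProjection Φ γ₁ P₁)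
    (h₂ : IsDichotomyProjection Φ γ₂ P₂) (hγ : γ₁ ≤ γ₂)
    (hrank : Module.finrank ℝ P₁.range = Module.finrank ℝ P₂.range) : P₁ = P₂ := by
  have hrange : P₁.range = P₂.range := Submodule.eq_of_le_of_finrank_eq
    (range_le_range_of_mul_eq_right (h₁.mul_eq_right_of_le h₂ hγ)) hrank
  rw [← h₁.mul_eq_left_of_le h₂ hγ]
  ext1 v
  obtain ⟨w, hw⟩ : P₂ v ∈ P₁.range := hrange ▸ ⟨v, rfl⟩
  change P₁ (P₂ v) = P₂ v
  rw [← hw]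
  exact congrArg (fun T : V →L[ℝ] V => T w) h₁.isIdempotentElem

/-- The part of the dichotomy resolvent set on which the dichotomy projection has rank `n`. -/
def dichotomyLevel (Φ : ℝ → (V →L[ℝ] V)ˣ) (n : ℕ) : Set ℝ :=
  {γ | ∃ P, IsDichotomyProjection Φ γ P ∧ Module.finrank ℝ P.range = n}

theorem isOpen_dichotomyLevel (Φ : ℝ → (V →L[ℝ] V)ˣ) (n : ℕ) : IsOpen (dichotomyLevel Φ n) :=
  isOpen_iff_mem_nhds.2 fun _ ⟨P, hP, hn⟩ => hP.eventually_nhds.mono fun _ hP' => ⟨P, hP', hn⟩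

theorem mem_dichotomyLevel_zero {γ β : ℝ} (h : HasBackwardExpBound Φ 1 β) (hγ : γ < β) :
    γ ∈ dichotomyLevel Φ 0 := by
  refine ⟨0, ⟨IsIdempotentElem.zero, ⟨γ - 1, by linarith, hasForwardExpBound_zero Φ _⟩,
    ⟨β, hγ, by rwa [sub_zero]⟩⟩, ?_⟩
  have hrange : (0 : V →L[ℝ] V).range = ⊥ := LinearMap.range_zero
  rw [hrange, finrank_bot]

theorem mem_dichotomyLevel_finrank {γ β : ℝ} (h : HasForwardExpBound Φ 1 β) (hγ : β < γ) :
    γ ∈ dichotomyLevel Φ (Module.finrank ℝ V) := by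
  refine ⟨1, ⟨IsIdempotentElem.one, ⟨β, hγ, h⟩,
    ⟨γ + 1, by linarith, by simpa only [sub_self] using hasBackwardExpBound_zero Φ _⟩⟩, ?_⟩
  have hrange : (1 : V →L[ℝ] V).range = ⊤ := LinearMap.range_id
  rw [hrange, finrank_top]

theorem not_bddBelow_dichotomyLevel_zero {β : ℝ} (h : HasBackwardExpBound Φ 1 β) :
    ¬ BddBelow (dichotomyLevel Φ 0) := fun hbdd =>
  not_bddBelow_Iio β (hbdd.mono fun _ => mem_dichotomyLevel_zero h)

theorem not_bddAbove_dichotomyLevel_finrank {β : ℝ} (h : HasForwardExpBound Φ 1 β) :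
    ¬ BddAbove (dichotomyLevel Φ (Module.finrank ℝ V)) := fun hbdd =>
  not_bddAbove_Ioi β (hbdd.mono fun _ => mem_dichotomyLevel_finrank h)

variable [FiniteDimensional ℝ V]

theorem ordConnected_dichotomyLevel (Φ : ℝ → (V →L[ℝ] V)ˣ) (n : ℕ) :
    (dichotomyLevel Φ n).OrdConnected := by
  refine ⟨fun γ₁ ⟨P₁, h₁, hn₁⟩ γ₂ ⟨P₂, h₂, hn₂⟩ γ hγ => ?_⟩
  obtain rfl := h₁.eq_of_finrank_range_eq h₂ (hγ.1.trans hγ.2) (hn₁.trans hn₂.symm)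
  exact ⟨P₁, h₁.of_mem_Icc h₂ hγ, hn₁⟩

theorem lt_of_mem_dichotomyLevel {m n : ℕ} (hmn : m < n) {γ₁ γ₂ : ℝ}
    (h₁ : γ₁ ∈ dichotomyLevel Φ m) (h₂ : γ₂ ∈ dichotomyLevel Φ n) : γ₁ < γ₂ := by
  obtain ⟨P₁, h₁, rfl⟩ := h₁
  obtain ⟨P₂, h₂, rfl⟩ := h₂
  by_contra! hγ
  exact hmn.not_ge (Submodule.finrank_mono
    (range_le_range_of_mul_eq_right (h₂.mul_eq_right_of_le h₁ hγ)))

theorem iUnion_dichotomyLevel (Φ : ℝ → (V →L[ℝ] V)ˣ) :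
    ⋃ n : Fin (Module.finrank ℝ V + 1), dichotomyLevel Φ n =
      {γ | ∃ P, IsDichotomyProjection Φ γ P} := by
  ext γ
  rw [mem_iUnion]
  exact ⟨fun ⟨_, P, hP, _⟩ => ⟨P, hP⟩, fun ⟨P, hP⟩ =>
    ⟨⟨_, Nat.lt_succ_of_le (Submodule.finrank_le P.range)⟩, P, hP, rfl⟩⟩

end DichotomyLevels

section OrderedFamilies

variable {α : Type*} [LinearOrder α]

/-- The gap between the set `U i`, if it is nonempty, and the next nonempty set of an increasing
family; the gap above an empty `U i` is empty, as it is part of that above an earlier set. -/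
def gapAbove {n : ℕ} (U : Fin (n + 1) → Set α) (i : Fin n) : Set α :=
  {x | (U i.castSucc).Nonempty ∧ x ∈ upperBounds (U i.castSucc) ∧
    ∀ j, i.castSucc < j → x ∈ lowerBounds (U j)}

variable {n : ℕ} {U : Fin (n + 1) → Set α}

theorem ordConnected_gapAbove (U : Fin (n + 1) → Set α) (i : Fin n) :
    (gapAbove U i).OrdConnected :=
  ⟨fun _ ⟨hne, hub, _⟩ _ ⟨_, _, hlb⟩ _ hz =>
    ⟨hne, fun _ hu => (hub hu).trans hz.1, fun j hj _ hu => hz.2.trans (hlb j hj hu)⟩⟩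

variable [TopologicalSpace α]

theorem isClosed_upperBounds [ClosedIciTopology α] (s : Set α) : IsClosed (upperBounds s) := by
  simp only [upperBounds, ofPred_forall]
  exact isClosed_biInter fun _ _ => isClosed_Ici

theorem isClosed_lowerBounds [ClosedIicTopology α] (s : Set α) : IsClosed (lowerBounds s) :=
  isClosed_upperBounds (α := αᵒᵈ) s

variable [OrderTopology α]

theorem isCompact_gapAbove [CompactIccSpace α] (htop : (U (Fin.last n)).Nonempty) (i : Fin n) :
    IsCompact (gapAbove U i) := by
  obtain ⟨y, hy⟩ := htop
  rcases (U i.castSucc).eq_empty_or_nonempty with hempty | ⟨x, hx⟩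
  · simp [gapAbove, hempty]
  · refine isCompact_Icc.of_isClosed_subset (s := Icc x y) ?_ fun z ⟨_, hub, hlb⟩ =>
      ⟨hub hx, hlb _ i.castSucc_lt_last hy⟩
    simp only [gapAbove, ofPred_and, ofPred_forall]
    exact isClosed_const.inter ((isClosed_upperBounds _).inter
      (isClosed_biInter fun j _ => isClosed_lowerBounds _))

variable [DenselyOrdered α]

theorem notMem_upperBounds_of_isOpen [NoMaxOrder α] {s : Set α} (hs : IsOpen s) {x : α}
    (hx : x ∈ s) : x ∉ upperBounds s := fun h =>
  lt_irrefl x (interior_Iic.subset (interior_maximal (fun _ hy => h hy) hs hx))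

theorem notMem_lowerBounds_of_isOpen [NoMinOrder α] {s : Set α} (hs : IsOpen s) {x : α}
    (hx : x ∈ s) : x ∉ lowerBounds s := fun h =>
  lt_irrefl x (interior_Ici.subset (interior_maximal (fun _ hy => h hy) hs hx))

theorem lt_of_mem_gapAbove [NoMinOrder α] (hopen : ∀ i, IsOpen (U i)) {i j : Fin n} (hij : i < j)
    {x y : α} (hx : x ∈ gapAbove U i) (hy : y ∈ gapAbove U j) : x < y := by
  obtain ⟨⟨u, hu⟩, hub, -⟩ := hy
  have hlb := hx.2.2 _ (Fin.castSucc_lt_castSucc_iff.2 hij)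
  refine ((hlb hu).lt_of_ne ?_).trans_le (hub hu)
  rintro rfl
  exact notMem_lowerBounds_of_isOpen (hopen _) hu hlb

theorem compl_iUnion_eq_iUnion_gapAbove [NoMinOrder α] [NoMaxOrder α] (hopen : ∀ i, IsOpen (U i))
    (hconn : ∀ i, (U i).OrdConnected) (hlt : ∀ i j, i < j → ∀ x ∈ U i, ∀ y ∈ U j, x < y)
    (hbot : ¬ BddBelow (U 0)) (htop : ¬ BddAbove (U (Fin.last n))) :
    (⋃ i, U i)ᶜ = ⋃ i, gapAbove U i := by
  ext x
  simp only [mem_compl_iff, mem_iUnion, not_exists]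
  refine ⟨fun hx => ?_, fun ⟨i, ⟨u, hu⟩, hub, hlb⟩ j hxj => ?_⟩
  · have hpart : ∀ i, ∀ y ∈ U i, y ≤ x → x ∈ upperBounds (U i) := fun i y hy hyx z hz =>
      le_of_not_gt fun hxz => hx i ((hconn i).out hy hz ⟨hyx, hxz.le⟩)
    obtain ⟨y₀, hy₀, hyx₀⟩ := not_bddBelow_iff.1 hbot x
    obtain ⟨m, ⟨y, hy, hyx⟩, hmax⟩ := (toFinite {i | ∃ y ∈ U i, y ≤ x}).exists_maximal
      ⟨0, y₀, hy₀, hyx₀.le⟩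
    have hm : m ≠ Fin.last n := by
      rintro rfl
      exact htop ⟨x, hpart _ y hy hyx⟩
    obtain ⟨i, rfl⟩ := Fin.exists_castSucc_eq.2 hm
    refine ⟨i, ⟨y, hy⟩, hpart _ y hy hyx, fun j hij z hz => ?_⟩
    exact le_of_not_ge fun hzx => hij.not_ge (hmax ⟨z, hz, hzx⟩ hij.le)
  · rcases lt_trichotomy j i.castSucc with hj | rfl | hj
    · exact (hlt _ _ hj x hxj u hu).not_ge (hub hu)
    · exact notMem_upperBounds_of_isOpen (hopen _) hxj hub
    · exact notMem_lowerBounds_of_isOpen (hopen _) hxj (hlb j hj)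

end OrderedFamilies

section OrderedIntervals

variable {α : Type*} [ConditionallyCompleteLinearOrder α] [TopologicalSpace α] [OrderTopology α]

theorem exists_iUnion_eq_iUnion_Icc {ι : Type*} [Fintype ι] [LinearOrder ι] {C : ι → Set α}
    (hcomp : ∀ i, IsCompact (C i)) (hconn : ∀ i, (C i).OrdConnected)
    (hlt : ∀ i j, i < j → ∀ x ∈ C i, ∀ y ∈ C j, x < y) :
    ∃ k ≤ Fintype.card ι, ∃ a b : Fin k → α, (∀ i, a i ≤ b i) ∧ (∀ i j, i < j → b i < a j) ∧
      ⋃ i, C i = ⋃ i, Icc (a i) (b i) := by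
  classical
  set s : Finset ι := {i | (C i).Nonempty} with hs
  let e : Fin s.card ↪o ι := s.orderEmbOfFin rfl
  have hne : ∀ i, (C (e i)).Nonempty := fun i =>
    (Finset.mem_filter.1 (s.orderEmbOfFin_mem rfl i)).2
  have hinf : ∀ i, sInf (C (e i)) ∈ C (e i) := fun i => (hcomp _).sInf_mem (hne i)
  have hsup : ∀ i, sSup (C (e i)) ∈ C (e i) := fun i => (hcomp _).sSup_mem (hne i)
  have hIcc : ∀ i, C (e i) = Icc (sInf (C (e i))) (sSup (C (e i))) := fun i =>
    ((hconn _).out (hinf i) (hsup i)).antisymm' fun x hx =>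
      ⟨csInf_le (hcomp _).bddBelow hx, le_csSup (hcomp _).bddAbove hx⟩
  refine ⟨s.card, s.card_le_univ, _, _, fun i => csInf_le (hcomp _).bddBelow (hsup i),
    fun i j hij => hlt _ _ (e.lt_iff_lt.2 hij) _ (hsup i) _ (hinf j), ?_⟩
  simp only [← hIcc]
  refine Subset.antisymm (iUnion_subset fun i x hx => ?_) (iUnion_subset fun i =>
    subset_iUnion C (e i))
  obtain ⟨j, rfl⟩ : i ∈ range e := by
    simpa [e, hs] using ⟨x, hx⟩
  exact mem_iUnion_of_mem j hx

theorem exists_compl_iUnion_eq_iUnion_Icc [DenselyOrdered α] [NoMinOrder α] [NoMaxOrder α]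
    {n : ℕ} {U : Fin (n + 1) → Set α} (hopen : ∀ i, IsOpen (U i))
    (hconn : ∀ i, (U i).OrdConnected) (hlt : ∀ i j, i < j → ∀ x ∈ U i, ∀ y ∈ U j, x < y)
    (hbot : ¬ BddBelow (U 0)) (htop : ¬ BddAbove (U (Fin.last n))) :
    ∃ k ≤ n, ∃ a b : Fin k → α, (∀ i, a i ≤ b i) ∧ (∀ i j, i < j → b i < a j) ∧
      (⋃ i, U i)ᶜ = ⋃ i, Icc (a i) (b i) := by
  have hne : (U (Fin.last n)).Nonempty := nonempty_of_not_bddAbove htop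
  obtain ⟨k, hk, h⟩ := exists_iUnion_eq_iUnion_Icc (isCompact_gapAbove hne)
    (ordConnected_gapAbove U) fun i j hij x hx y hy => lt_of_mem_gapAbove hopen hij hx hy
  rw [compl_iUnion_eq_iUnion_gapAbove hopen hconn hlt hbot htop]
  exact ⟨k, by simpa using hk, h⟩

end OrderedIntervals

section DichotomySpectrum

theorem nonempty_compl_iUnion_of_isOpen {X ι : Type*} [TopologicalSpace X] [PreconnectedSpace X]
    {U : ι → Set X} (hopen : ∀ i, IsOpen (U i)) (hdisj : Pairwise (Function.onFun Disjoint U))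
    {i j : ι} (hij : i ≠ j) (hi : (U i).Nonempty) (hj : (U j).Nonempty) :
    (⋃ i, U i)ᶜ.Nonempty := by
  rw [nonempty_compl]
  intro hU
  have hcover : U i ∪ ⋃ k ≠ i, U k = univ := (iSup_split_single U i).symm.trans hU
  have hdisj' : Disjoint (U i) (⋃ k ≠ i, U k) :=
    disjoint_iUnion₂_right.2 fun k hk => hdisj hk.symm
  exact (nonempty_inter (hopen i) (isOpen_biUnion fun k _ => hopen k) hcover hi
    (hj.mono (subset_biUnion_of_mem (u := U) hij.symm))).ne_empty hdisj'.inter_eq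

variable {N : ℕ} {A : ℝ → L N} {Φ : ℝ → (L N)ˣ}

theorem HasBoundedGrowth.exists_hasForwardExpBound_hasBackwardExpBound (h : HasBoundedGrowth A) :
    ∃ Φ : ℝ → (L N)ˣ, IsFundamental A Φ ∧
      ∃ α, HasForwardExpBound Φ 1 α ∧ HasBackwardExpBound Φ 1 (-α) := by
  obtain ⟨Φ, hΦ, K, α, hK, -, hgrowth⟩ := h
  refine ⟨Φ, hΦ, α, ⟨K, hK, fun t s hts => ?_⟩, ⟨K, hK, fun t s hts => ?_⟩⟩
  · simpa only [mul_one, abs_of_nonneg (sub_nonneg.2 hts)] using hgrowth t s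
  · simpa only [mul_one, abs_of_nonpos (sub_nonpos.2 hts), mul_neg, neg_mul] using hgrowth t s

theorem IsFundamental.dichotomySpectrum_eq (hΦ : IsFundamental A Φ) :
    dichotomySpectrum A = (⋃ n : Fin (N + 1), dichotomyLevel Φ n)ᶜ := by
  have hlevels := iUnion_dichotomyLevel Φ
  rw [finrank_euclideanSpace_fin] at hlevels
  rw [hlevels]
  ext γ
  exact not_congr (hΦ.hasExpDichotomy_sub_smul_one_iff γ)

theorem HasBoundedGrowth.exists_dichotomySpectrum_eq_iUnion_Icc (hN : 1 ≤ N)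
    (h : HasBoundedGrowth A) :
    ∃ (k : ℕ) (a b : Fin k → ℝ), 1 ≤ k ∧ k ≤ N ∧ (∀ i, a i ≤ b i) ∧
      (∀ i j, i < j → b i < a j) ∧ dichotomySpectrum A = ⋃ i, Icc (a i) (b i) := by
  obtain ⟨Φ, hΦ, α, hfwd, hbwd⟩ := h.exists_hasForwardExpBound_hasBackwardExpBound
  let U : Fin (N + 1) → Set ℝ := fun n => dichotomyLevel Φ n
  have hopen : ∀ n, IsOpen (U n) := fun n => isOpen_dichotomyLevel Φ n
  have hlt : ∀ m n, m < n → ∀ γ ∈ U m, ∀ γ' ∈ U n, γ < γ' := fun m n hmn γ hγ γ' hγ' =>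
    lt_of_mem_dichotomyLevel hmn hγ hγ'
  have hbot : ¬ BddBelow (U 0) := not_bddBelow_dichotomyLevel_zero hbwd
  have htop : ¬ BddAbove (U (Fin.last N)) := by
    have hlast := not_bddAbove_dichotomyLevel_finrank hfwd
    rwa [finrank_euclideanSpace_fin] at hlast
  have hspec : dichotomySpectrum A = (⋃ n, U n)ᶜ := hΦ.dichotomySpectrum_eq
  have hdisj : Pairwise (Function.onFun Disjoint U) := fun m n hmn => disjoint_left.2
    fun γ hm hn => hmn.lt_or_gt.elim (fun hlt' => (hlt _ _ hlt' γ hm γ hn).false)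
      fun hlt' => (hlt _ _ hlt' γ hn γ hm).false
  have h0N : (0 : Fin (N + 1)) ≠ Fin.last N := ne_of_lt (Fin.lt_def.2 hN)
  have hne : (dichotomySpectrum A).Nonempty := hspec ▸ nonempty_compl_iUnion_of_isOpen hopen hdisj
    h0N (nonempty_of_not_bddBelow hbot) (nonempty_of_not_bddAbove htop)
  obtain ⟨k, hkN, a, b, hab, hba, hIcc⟩ := exists_compl_iUnion_eq_iUnion_Icc hopen
    (fun n => ordConnected_dichotomyLevel Φ n) hlt hbot htop
  rw [← hspec] at hIcc
  refine ⟨k, a, b, Nat.one_le_iff_ne_zero.2 ?_, hkN, hab, hba, hIcc⟩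
  rintro rfl
  rw [hIcc, iUnion_of_empty] at hne
  exact not_nonempty_empty hne

end DichotomySpectrum

section GlobalSolutions

variable {N : ℕ} {g : ℝ → E N → E N} {x₀ : E N} {x y : ℝ → E N}

theorem isGlobalSolution_iff_isCaratheodorySolution :
    IsGlobalSolution g x₀ x ↔ IsCaratheodorySolution g x ∧ x 0 = x₀ := by
  constructor
  · rintro ⟨-, hi, h⟩
    obtain rfl : x 0 = x₀ := by simpa using h 0
    exact ⟨(isCaratheodorySolution_iff_eq_add_integral 0).2
      ⟨locallyIntegrable_iff_forall_intervalIntegrable.2 hi, h⟩, rfl⟩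
  · rintro ⟨hx, rfl⟩
    exact ⟨hx.continuous, locallyIntegrable_iff_forall_intervalIntegrable.1 hx.1,
      ((isCaratheodorySolution_iff_eq_add_integral 0).1 hx).2⟩

theorem isGlobalSolution_sol (h : GloballyDefined g x₀) : IsGlobalSolution g x₀ (sol g x₀) := by
  rw [sol, dif_pos h]
  exact h.choose_spec

theorem IsCaratheodorySolution.eq_of_eq_at_of_mem_LC (hg : g ∈ LC N (E N))
    (hx : IsCaratheodorySolution g x) (hy : IsCaratheodorySolution g y) {s : ℝ}
    (hs : x s = y s) : x = y := by
  refine hx.eq_of_eq_at hy (fun a b => ?_) hs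
  obtain ⟨l, hl, hlip⟩ := hg.2 (x '' uIcc a b ∪ y '' uIcc a b)
    ((isCompact_uIcc.image hx.continuous).union (isCompact_uIcc.image hy.continuous))
  refine ⟨l, intervalIntegrable_of_locallyIntegrable hl a b, ?_⟩
  filter_upwards [hlip] with r hr hrab
  exact hr _ (.inl (mem_image_of_mem x (uIoc_subset_uIcc hrab))) _
    (.inr (mem_image_of_mem y (uIoc_subset_uIcc hrab)))

theorem sol_translate (hg : g ∈ LC N (E N)) (h : GloballyDefined g x₀) (t : ℝ) :
    sol (translate t g) (sol g x₀ t) = fun s => sol g x₀ (s + t) := by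
  obtain ⟨hx, -⟩ := isGlobalSolution_iff_isCaratheodorySolution.1 (isGlobalSolution_sol h)
  have hxt : IsGlobalSolution (translate t g) (sol g x₀ t) fun s => sol g x₀ (s + t) :=
    isGlobalSolution_iff_isCaratheodorySolution.2 ⟨hx.comp_add_right t, by rw [zero_add]⟩
  obtain ⟨hz, hz0⟩ :=
    isGlobalSolution_iff_isCaratheodorySolution.1 (isGlobalSolution_sol ⟨_, hxt⟩)
  have htr : (fun s => translate t g (s + -t)) = g := by
    funext s y
    rw [translate, neg_add_cancel_right]
  have hzt := htr ▸ hz.comp_add_right (-t)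
  have heq := hzt.eq_of_eq_at_of_mem_LC hg hx (s := t) (by rw [add_neg_cancel]; exact hz0)
  funext s
  simpa only [add_neg_cancel_right] using congrFun heq (s + t)

end GlobalSolutions

section CompositionWithCurves

variable {N : ℕ} {V : Type} [NormedAddCommGroup V] {f : ℝ → E N → V} {x : ℝ → E N}

theorem IsMBound.norm_comp_le_comp_sub [NormedSpace ℝ V] {K : Set (E N)} {m : ℝ → ℝ} {t : ℝ}
    (hm : IsMBound (translate t f) K m) (hx : ∀ u, x u ∈ K) :
    ∀ᵐ u, ‖f u (x u)‖ ≤ m (u - t) := by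
  filter_upwards [(measurePreserving_sub_right volume t).quasiMeasurePreserving.ae hm.2] with u hu
  simpa only [translate, sub_add_cancel] using hu _ (hx u)

variable [MeasurableSpace V] [OpensMeasurableSpace V] [SecondCountableTopology V]

theorem IsC.locallyIntegrable_comp (hf : IsC f) (hx : Continuous x) :
    LocallyIntegrable fun t => f t (x t) := by
  refine locallyIntegrable_iff_forall_intervalIntegrable.2 fun a b => ?_
  obtain ⟨m, hm, hfm⟩ := hf.2 _ ((isCompact_uIcc (a := a) (b := b)).image hx)
  have hmeas : Measurable fun t => f t (x t) := hf.1.comp (measurable_id.prodMk hx.measurable)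
  refine (intervalIntegrable_of_locallyIntegrable hm a b).mono_fun hmeas.aestronglyMeasurable
    ((ae_restrict_iff' measurableSet_uIoc).2 ?_)
  filter_upwards [hfm] with t ht htab
  exact (ht _ (mem_image_of_mem x (uIoc_subset_uIcc htab))).trans (le_abs_self _)

theorem HasBoundedMBounds.exists_integral_norm_comp_le [NormedSpace ℝ V]
    (hfb : HasBoundedMBounds f) (hf : IsC f) (hx : Continuous x) {c : ℝ} (hc : ∀ t, ‖x t‖ ≤ c) :
    ∃ C : ℝ, ∀ t, ∫ u in t..t + 1, ‖f u (x u)‖ ≤ C := by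
  obtain ⟨j, hj⟩ := exists_nat_ge c
  obtain ⟨S, -, hS, hSb⟩ := hfb j
  obtain ⟨C, hC⟩ := hSb 1 one_pos
  refine ⟨C, fun t => ?_⟩
  obtain ⟨m, hmS, hm⟩ := hS _ (mem_range_self t)
  have hint := intervalIntegrable_of_locallyIntegrable
    fun r => (hf.locallyIntegrable_comp hx r).norm
  have hmt : IntervalIntegrable (fun u => m (u - t)) volume (-1 + t) (1 + t) :=
    (intervalIntegrable_of_locallyIntegrable hm.1 (-1) 1).comp_sub_right t
  calc ∫ u in t..t + 1, ‖f u (x u)‖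
      ≤ ∫ u in (-1 + t)..(1 + t), ‖f u (x u)‖ :=
        intervalIntegral.integral_mono_interval (by linarith) (by linarith) (by linarith)
          (ae_of_all _ fun u => norm_nonneg _) (hint _ _)
    _ ≤ ∫ u in (-1 + t)..(1 + t), m (u - t) :=
        intervalIntegral.integral_mono_ae (by linarith) (hint _ _) hmt
          (hm.norm_comp_le_comp_sub fun u => mem_closedBall_zero_iff.2 ((hc u).trans hj))
    _ = ∫ u in (-1)..1, m u := by simp [intervalIntegral.integral_comp_sub_right]
    _ ≤ C := hC m hmS

end CompositionWithCurves

section BaseFlow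

variable {N : ℕ}

theorem coeff_eq_of_tendsto {ω : Triple N} {B : L N}
    (h : Tendsto (fun h : ℝ => h⁻¹ • ∫ s in (0 : ℝ)..h, ω.2.1 s (sol ω.1 ω.2.2 s)) (𝓝[≠] 0)
      (𝓝 B)) : coeff ω = B := by
  have hex : ∃ B : L N, Tendsto (fun h : ℝ => h⁻¹ • ∫ s in (0 : ℝ)..h,
    ω.2.1 s (sol ω.1 ω.2.2 s)) (𝓝[≠] 0) (𝓝 B) := ⟨B, h⟩
  rw [coeff, dif_pos hex]
  exact tendsto_nhds_unique hex.choose_spec h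

theorem coeff_baseFlow_ae_eq {g : ℝ → E N → E N} {G : ℝ → E N → L N} {x₀ : E N}
    (hg : g ∈ LC N (E N)) (hG : IsC G) (h : GloballyDefined g x₀) :
    (fun t => coeff (baseFlow (g, G, x₀) t)) =ᵐ[volume] fun t => G t (sol g x₀ t) := by
  have hint := hG.locallyIntegrable_comp (isGlobalSolution_sol h).1
  filter_upwards [LocallyIntegrable.ae_hasDerivAt_integral hint] with t ht
  refine coeff_eq_of_tendsto ?_
  have hslope := hasDerivAt_iff_tendsto_slope_zero.1 (ht t)
  simp only [intervalIntegral.integral_same, sub_zero] at hslope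
  refine hslope.congr fun r => ?_
  simp only [baseFlow, sol_translate hg h t, translate]
  rw [intervalIntegral.integral_comp_add_right (fun s => G s (sol g x₀ s)), zero_add, add_comm r]

theorem mem_LC_and_isC_of_mem_Omega {f : ℝ → E N → E N} {F : ℝ → E N → L N} {ω : Triple N}
    (h : ω ∈ OmegaStrong f F ∨ ω ∈ OmegaSigma f F) : ω.1 ∈ LC N (E N) ∧ IsC ω.2.1 := by
  rcases h with ⟨p, -, hfst, hsnd⟩ | ⟨p, -, hfst, hsnd⟩ <;>
    exact ⟨hfst ▸ p.1.2, hsnd ▸ p.2.2.1⟩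

end BaseFlow

end Carath

theorem mainTheorem6_general (N : ℕ) (hN : 1 ≤ N)
    (g : ℝ → Carath.E N → Carath.E N) (G : ℝ → Carath.E N → Carath.L N) (x₀ : Carath.E N)
    (hg : g ∈ Carath.LC N (Carath.E N)) (hGC : Carath.IsC G)
    (hglob : Carath.GloballyDefined g x₀)
    (hG : Carath.HasBoundedMBounds G)
    (hx : ∃ C : ℝ, ∀ t : ℝ, ‖Carath.sol g x₀ t‖ ≤ C) :
    Carath.HasBoundedGrowth (fun t => Carath.coeff (Carath.baseFlow (g, G, x₀) t)) ∧
    ∃ (k : ℕ) (a b : Fin k → ℝ), 1 ≤ k ∧ k ≤ N ∧ (∀ i, a i ≤ b i) ∧ (∀ i j, i < j → b i < a j) ∧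
      Carath.dichotomySpectrum (fun t => Carath.coeff (Carath.baseFlow (g, G, x₀) t)) =
        ⋃ i, Icc (a i) (b i) := by
  have hcont := (Carath.isGlobalSolution_sol hglob).1
  have hcoeff := Carath.coeff_baseFlow_ae_eq hg hGC hglob
  obtain ⟨c, hc⟩ := hx
  obtain ⟨C, hC⟩ := hG.exists_integral_norm_comp_le hGC hcont hc
  have hint : LocallyIntegrable fun t => Carath.coeff (Carath.baseFlow (g, G, x₀) t) :=
    (hGC.locallyIntegrable_comp hcont).congr hcoeff.symm
  have hgrowth : Carath.HasBoundedGrowth fun t =>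
      Carath.coeff (Carath.baseFlow (g, G, x₀) t) := by
    refine Carath.hasBoundedGrowth_of_integral_norm_le hint (C := C) fun t => ?_
    calc _ = ∫ u in t..t + 1, ‖G u (Carath.sol g x₀ u)‖ :=
          intervalIntegral.integral_congr_ae ((hcoeff.fun_comp norm).mono fun _ hu _ => hu)
      _ ≤ C := hC t
  exact ⟨hgrowth, hgrowth.exists_dichotomySpectrum_eq_iUnion_Icc hN⟩

theorem mainTheorem6 (N : ℕ) (hN : 1 ≤ N)
    (f : ℝ → Carath.E N → Carath.E N) (F : ℝ → Carath.E N → Carath.L N)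
    (hf : f ∈ Carath.LC N (Carath.E N)) (hF : Carath.IsJacobian f F)
    (hfm : Carath.HasEquicontinuousMBounds f)
    (g : ℝ → Carath.E N → Carath.E N) (G : ℝ → Carath.E N → Carath.L N) (x₀ : Carath.E N)
    (hω : (g, G, x₀) ∈ Carath.OmegaStrong f F ∨
      (Carath.HasEquicontinuousMBounds F ∧ (g, G, x₀) ∈ Carath.OmegaSigma f F))
    (hglob : Carath.GloballyDefined g x₀)
    (hG : Carath.HasBoundedMBounds G)
    (hx : ∃ C : ℝ, ∀ t : ℝ, ‖Carath.sol g x₀ t‖ ≤ C) :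
    Carath.HasBoundedGrowth (fun t => Carath.coeff (Carath.baseFlow (g, G, x₀) t)) ∧
    ∃ (k : ℕ) (a b : Fin k → ℝ), 1 ≤ k ∧ k ≤ N ∧ (∀ i, a i ≤ b i) ∧ (∀ i j, i < j → b i < a j) ∧
      Carath.dichotomySpectrum (fun t => Carath.coeff (Carath.baseFlow (g, G, x₀) t)) =
        ⋃ i, Icc (a i) (b i) := by
  obtain ⟨hg, hGC⟩ := Carath.mem_LC_and_isC_of_mem_Omega (hω.imp_right And.right)
  exact mainTheorem6_general N hN g G x₀ hg hGC hglob hG hx
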